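/- \textbf{Setting.} Let $0<T<\infty$, let $(\Omega,\mathcal F,(\mathcal F_t)_{0\le t\le T},\mathbb P)$ be a filtered probability space satisfying the usual conditions, and assume that $(\Omega,\mathcal F_t,\mathbb P|_{\mathcal F_t})$ is non-atomic for every $0<t\le T$. Let $\mathcal T$ be the set of all stopping times with values in $[0,T]$ and $Y=(Y_t)_{0\le t\le T}$ an adapted right-continuous real process. Let $\mathcal S$ be a compact metric space with distance $d$, let $\mathcal M(\mathcal S)$ be the set of Borel probability measures on $\mathcal S$ with the weak topology, and let $\mathcal P\in\mathcal M(\mathcal S)$. Let $(\mathbb P^\theta)_{\theta\in\mathcal S}$ be a probability kernel from $\mathcal S$ to $(\Omega,\mathcal F)$, with expectations $\mathbb E^\theta$, and for $\mathcal Q\in\mathcal M(\mathcal S)$ put $\mathbb P^{\mathcal Q}(d\theta,d\omega)=\mathcal Q(d\theta)\,\mathbb P^\theta(d\omega)$ on $\mathcal S\times\Omega$. Assume: 1. $\mathbb P^\theta\ll\mathbb P$ for all $\theta$; write $D^\theta=d\mathbb P^\theta/d\mathbb P$. 2. There is $C<\infty$ with $\mathbb E^\theta[\sup_{0\le t\le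 T}|Y_t|]<C$ for all $\theta$. 3. If $\tau_n,\tau\in\mathcal T$ and $\tau_n\to\tau$ almost surely, then $\mathbb E^\theta[Y_{\tau_n}-Y_\tau]\to0$ uniformly in $\theta\in\mathcal S$. 4. $\sup_{d(\theta_1,\theta_2)\le h}\mathbb E\big[|D^{\theta_1}-D^{\theta_2}|\sup_{0\le t\le T}|Y_t|\big]\to0$ as $h\downarrow0$. Let $v:\mathbb R\to[-\infty,\infty)$ be a proper concave nondecreasing upper semicontinuous function, $v^{-1}(y)=\sup\{m\in\mathbb R: v(m)\le y\}$, and $U(X)=v^{-1}\big(\int_{\mathcal S}v(X(\theta))\,\mathcal P(d\theta)\big)$. Call $R:\mathcal M(\mathcal S)\times\mathbb R\to[-\infty,\infty]$ a \emph{dual function} of $U$ if $U(X)=\inf_{\mathcal Q\in\mathcal M(\mathcal S)}R(\mathcal Q,\int X\,d\mathcal Q)$ for all $X\in C(\mathcal S)$ and: (i) $R(\mathcal Q,\cdot)$ is nondecreasing and right-continuous for every $\mathcal Q$; (ii) $R$ is jointly quasi-convex; (iii) $\lim_{s\to\infty}R(\mathcal Q,s)$ does not depend on $\mathcal Q$;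 (iv) $\mathcal Q\mapsto\sup_{s'<s}R(\mathcal Q,s')$ is lower semicontinuous for every $s$. \textbf{Theorem.} A dual function of $U$ exists; namely, $(\mathcal Q,s)\mapsto\inf_{s'>s}\,\sup\{U(X): X\in C(\mathcal S),\ \int X\,d\mathcal Q\le s'\}$ is one. Let $R$ be any dual function of $U$, and suppose in addition that one of the following holds: 5(i). $R(\mathcal Q,\cdot)$ is continuous on $\mathbb R$ for every $\mathcal Q$; or 5(ii). $R(\mathcal Q,\cdot)$ is continuous on $(0,\infty)$ for every $\mathcal Q$, and $\mathbb E^\theta[Y_\tau]>0$ for all $\tau\in\mathcal T$, $\theta\in\mathcal S$. Put $G(\tau,\mathcal Q)=R(\mathcal Q,\mathbb E^{\mathbb P^{\mathcal Q}}[Y_\tau])$. Then $$\sup_{\tau\in\mathcal T}v^{-1}\Big(\int_{\mathcal S}v\big(\mathbb E^\theta[Y_\tau]\big)\,\mathcal P(d\theta)\Big)=\sup_{\tau\in\mathcal T}\inf_{\mathcal Q\in\mathcal M(\mathcal S)}G(\tau,\mathcal Q)=\inf_{\mathcal Q\in\mathcal M(\mathcal S)}\sup_{\tau\in\mathcal T}G(\tau,\mathcal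 Q),$$ and the inner problem on the right is a classical optimal stopping problem: for every $\mathcal Q\in\mathcal M(\mathcal S)$, $\sup_{\tau\in\mathcal T}\mathbb E^{\mathbb P^{\mathcal Q}}[Y_\tau]$ is finite and $\sup_{\tau\in\mathcal T}G(\tau,\mathcal Q)=R\big(\mathcal Q,\sup_{\tau\in\mathcal T}\mathbb E^{\mathbb P^{\mathcal Q}}[Y_\tau]\big)$. -/

import Mathlib

open Filter Topology MeasureTheory ProbabilityTheory
open scoped NNReal ENNReal

namespace AmbiguityStopping

noncomputable section

/-! ### Filtered probability space and stopping times on `[0, T]` -/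

/-- The time interval `[0, T]`. -/
abbrev Time (T : ℝ) : Type := Set.Icc (0 : ℝ) T

/-- The usual conditions: the filtration is right-continuous and every `P`-null set (measurable
or not, so that `P` is in particular complete) belongs to every `𝓕 t`. -/
structure UsualConditions {Ω : Type*} [mΩ : MeasurableSpace Ω] {T : ℝ} (P : Measure Ω)
    (𝓕 : Filtration (Time T) mΩ) : Prop where
  rightContinuous : 𝓕.IsRightContinuous
  complete : ∀ A : Set Ω, P A = 0 → ∀ t, MeasurableSet[𝓕 t] A

/-- `(Ω, m, P)` is non-atomic: every event of `m` of positive probability contains an event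
of `m` of strictly smaller positive probability. -/
def NonAtomicOn {Ω : Type*} [MeasurableSpace Ω] (P : Measure Ω) (m : MeasurableSpace Ω) : Prop :=
  ∀ A : Set Ω, MeasurableSet[m] A → 0 < P A →
    ∃ B : Set Ω, B ⊆ A ∧ MeasurableSet[m] B ∧ 0 < P B ∧ P B < P A

/-- The set of all stopping times with values in `[0, T]`. -/
abbrev StopTime {Ω : Type*} [mΩ : MeasurableSpace Ω] {T : ℝ} (𝓕 : Filtration (Time T) mΩ) :
    Type _ :=
  {τ : Ω → Time T // IsStoppingTime 𝓕 (fun ω => ((τ ω : Time T) : WithTop (Time T)))}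

/-- The pay-off `Y_τ`. -/
def payoff {Ω : Type*} [mΩ : MeasurableSpace Ω] {T : ℝ} {𝓕 : Filtration (Time T) mΩ}
    (Y : Time T → Ω → ℝ) (τ : StopTime 𝓕) (ω : Ω) : ℝ :=
  Y (τ.1 ω) ω

/-- The running supremum `sup_{0 ≤ t ≤ T} |Y_t|`. -/
def supAbs {Ω : Type*} {T : ℝ} (Y : Time T → Ω → ℝ) (ω : Ω) : ℝ≥0∞ :=
  ⨆ t, ‖Y t ω‖ₑ

/-! ### Scenarios -/

section Scenarios

variable {S Ω : Type*} [MetricSpace S] [MeasurableSpace S] [mΩ : MeasurableSpace Ω] {T : ℝ}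
  {𝓕 : Filtration (Time T) mΩ}

/-- The scenario expectation `E^θ[Y_τ]`. -/
def scenarioValue (κ : Kernel S Ω) (Y : Time T → Ω → ℝ) (τ : StopTime 𝓕) (θ : S) : ℝ :=
  ∫ ω, payoff Y τ ω ∂(κ θ)

/-- The expectation `E^{P^Q}[Y_τ]` under the measure `P^Q(dθ, dω) = Q(dθ) P^θ(dω)` on `S × Ω`. -/
def mixedValue (κ : Kernel S Ω) (Y : Time T → Ω → ℝ) (τ : StopTime 𝓕)
    (Q : ProbabilityMeasure S) : ℝ :=
  ∫ p, payoff Y τ p.2 ∂((Q : Measure S) ⊗ₘ κ)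

/-- Uniform integrability bound: `E^θ[sup_t |Y_t|] < C` for all scenarios. -/
def UniformlyIntegrablePayoff (κ : Kernel S Ω) (Y : Time T → Ω → ℝ) : Prop :=
  ∃ C : ℝ≥0, ∀ θ, ∫⁻ ω, supAbs Y ω ∂(κ θ) < C

/-- If `τ_n → τ` almost surely, then `E^θ[Y_{τ_n} - Y_τ] → 0` uniformly in `θ`. -/
def ContinuousAlongStopTimes (P : Measure Ω) (𝓕 : Filtration (Time T) mΩ) (κ : Kernel S Ω)
    (Y : Time T → Ω → ℝ) : Prop :=
  ∀ (τs : ℕ → StopTime 𝓕) (τ : StopTime 𝓕),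
    (∀ᵐ ω ∂P, Tendsto (fun n => (τs n).1 ω) atTop (𝓝 (τ.1 ω))) →
      TendstoUniformly (fun n θ => ∫ ω, (payoff Y (τs n) ω - payoff Y τ ω) ∂(κ θ))
        (fun _ => 0) atTop

/-- `sup_{d(θ₁, θ₂) ≤ h} E[|D^{θ₁} - D^{θ₂}| sup_t |Y_t|] → 0` as `h → 0+`, where `D^θ` is the
Radon-Nikodym derivative of `P^θ` with respect to `P`. -/
def ContinuousInScenario (P : Measure Ω) (κ : Kernel S Ω) (Y : Time T → Ω → ℝ) : Prop :=
  Tendsto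
    (fun h : ℝ => ⨆ (θ₁ : S) (θ₂ : S) (_ : dist θ₁ θ₂ ≤ h),
      ∫⁻ ω, ENNReal.ofReal
          |((κ θ₁).rnDeriv P ω).toReal - ((κ θ₂).rnDeriv P ω).toReal| * supAbs Y ω ∂P)
    (𝓝[>] 0) (𝓝 0)

end Scenarios

/-! ### Smooth ambiguity preferences -/

/-- A proper concave nondecreasing upper semicontinuous function `v : ℝ → [-∞, ∞)`. -/
structure IsUtility (v : ℝ → EReal) : Prop where
  ne_top : ∀ x, v x ≠ ⊤
  exists_ne_bot : ∃ x, v x ≠ ⊥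
  mono : Monotone v
  concave : ∀ x y a b : ℝ, 0 ≤ a → 0 ≤ b → a + b = 1 →
    (a : EReal) * v x + (b : EReal) * v y ≤ v (a * x + b * y)
  usc : UpperSemicontinuous v

/-- The right-continuous (generalised) inverse `v⁻¹(y) = sup {m ∈ ℝ : v(m) ≤ y}`. -/
def genInverse (v : ℝ → EReal) (y : EReal) : EReal :=
  ⨆ (m : ℝ) (_ : v m ≤ y), (m : EReal)

/-- The integral of an extended real function, positive part minus negative part. It is used
only for functions that are bounded above by a real number. -/
def eintegral {S : Type*} [MeasurableSpace S] (μ : Measure S) (f : S → EReal) : EReal :=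
  ((∫⁻ θ, (f θ).toENNReal ∂μ : ℝ≥0∞) : EReal) - ((∫⁻ θ, (-f θ).toENNReal ∂μ : ℝ≥0∞) : EReal)

/-- The certainty equivalent `v⁻¹(∫ v(X(θ)) μ₀(dθ))`. -/
def certaintyEquiv {S : Type*} [MeasurableSpace S] (μ₀ : ProbabilityMeasure S) (v : ℝ → EReal)
    (X : S → ℝ) : EReal :=
  genInverse v (eintegral (μ₀ : Measure S) fun θ => v (X θ))

section Dual

variable {S : Type*} [MetricSpace S] [CompactSpace S] [MeasurableSpace S] [BorelSpace S]

/-- `R` is a dual function of the certainty equivalent: it represents the certainty equivalent of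
every continuous `X : S → ℝ` as `inf_Q R(Q, E^Q[X])` and has the regularity properties that
single it out. -/
structure IsDualFunction (μ₀ : ProbabilityMeasure S) (v : ℝ → EReal)
    (R : ProbabilityMeasure S → ℝ → EReal) : Prop where
  represents : ∀ X : C(S, ℝ),
    certaintyEquiv μ₀ v X = ⨅ Q : ProbabilityMeasure S, R Q (∫ θ, X θ ∂(Q : Measure S))
  mono : ∀ Q, Monotone (R Q)
  rightContinuous : ∀ Q s, ContinuousWithinAt (R Q) (Set.Ici s) s
  quasiconvex : ∀ (Q₁ Q₂ Q : ProbabilityMeasure S) (s₁ s₂ : ℝ) (a b : ℝ≥0), a + b = 1 →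
    (Q : Measure S) = a • (Q₁ : Measure S) + b • (Q₂ : Measure S) →
    R Q (a * s₁ + b * s₂) ≤ max (R Q₁ s₁) (R Q₂ s₂)
  limit : ∃ l : EReal, ∀ Q, Tendsto (R Q) atTop (𝓝 l)
  lsc : ∀ s : ℝ, LowerSemicontinuous fun Q : ProbabilityMeasure S => ⨆ s' : Set.Iio s, R Q s'

/-- The explicit dual function: the right-continuous version in `s` of
`sup {certaintyEquiv X : X ∈ C(S), E^Q[X] ≤ s}`. -/
def dualFunction (μ₀ : ProbabilityMeasure S) (v : ℝ → EReal) (Q : ProbabilityMeasure S) (s : ℝ) :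
    EReal :=
  ⨅ s' : Set.Ioi s, ⨆ X : {X : C(S, ℝ) // ∫ θ, X θ ∂(Q : Measure S) ≤ s'},
    certaintyEquiv μ₀ v X.1

/-- One of: `R` is continuous in the second argument on `ℝ`; or `R` is continuous in the second
argument on `(0, ∞)` and all `E^θ[Y_τ]` are positive. -/
def ContinuityAlternative {Ω : Type*} [mΩ : MeasurableSpace Ω] {T : ℝ}
    (𝓕 : Filtration (Time T) mΩ) (κ : Kernel S Ω) (Y : Time T → Ω → ℝ)
    (R : ProbabilityMeasure S → ℝ → EReal) : Prop :=
  (∀ Q, Continuous (R Q)) ∨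
    ((∀ Q, ContinuousOn (R Q) (Set.Ioi 0)) ∧
      ∀ (τ : StopTime 𝓕) (θ : S), 0 < scenarioValue κ Y τ θ)

/-- `G(τ, Q) = R(Q, E^{P^Q}[Y_τ])`. -/
def dualGain {Ω : Type*} [mΩ : MeasurableSpace Ω] {T : ℝ} {𝓕 : Filtration (Time T) mΩ}
    (R : ProbabilityMeasure S → ℝ → EReal) (κ : Kernel S Ω) (Y : Time T → Ω → ℝ)
    (τ : StopTime 𝓕) (Q : ProbabilityMeasure S) : EReal :=
  R Q (mixedValue κ Y τ Q)

end Dual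

end

end AmbiguityStopping

/-! Everything takes place in C(S). By concavity and Fatou's lemma, the superlevel sets {α ≤ U} of
the certainty equivalent are convex, closed and upward closed. A point outside such a set is
separated from it by a functional that must be positive, hence by a probability measure after
normalisation. This is the nontrivial half of the duality, `iInf_dualFunction_le`.

For the minimax identity let K be the set of functions θ ↦ E^θ[Y_τ]. By Fubini, G(τ, Q) = R(Q, ∫ X
dQ) with X ∈ K. The set K need not be convex, but its closure is: delay two stopping times to a
small δ > 0 and follow one or the other according to an event A of 𝓕 δ, chosen by an approximate
Lyapunov theorem for non-atomic measures. That theorem handles finitely many scenarios at once, and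
compactness of S extends the estimate to all of them (`exists_scenarioValue_approx_combination`).

Sion's theorem applies to the compact set of probability measures and the convex hull of K. Its
value is the supremum of U over the hull, which equals that over K because continuity of R in its
second argument makes U lower semicontinuous at points of the hull
(`IsDualFunction.exists_pos_forall_le`). The inner problem is classical because R(Q, ·) is monotone
and continuous at the supremum. -/

namespace AmbiguityStopping

/-! ### Superlevel sets of the certainty equivalent -/

section CertaintyEquivalent

/-- `α ≤ v⁻¹(y)` holds exactly if `v ≤ y` to the left of `α`. -/
lemma le_genInverse_iff {v : ℝ → EReal} (hv : Monotone v) {α y : EReal} :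
    α ≤ genInverse v y ↔ ∀ m : ℝ, (m : EReal) < α → v m ≤ y := by
  constructor
  · intro h m hm
    have h1 : (m : EReal) < ⨆ (m' : ℝ) (_ : v m' ≤ y), (m' : EReal) := lt_of_lt_of_le hm h
    simp only [lt_iSup_iff] at h1
    obtain ⟨m', hm', hlt⟩ := h1
    exact (hv (EReal.coe_lt_coe_iff.1 hlt).le).trans hm'
  · intro h
    refine le_of_forall_lt fun c hc => ?_
    obtain ⟨m, hcm, hm⟩ := EReal.lt_iff_exists_real_btwn.1 hc
    exact hcm.trans_le (le_iSup₂_of_le m (h m hm) le_rfl)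

lemma exists_nonneg_upper_bound {v : ℝ → EReal} (hv : IsUtility v) (b : ℝ) :
    ∃ M : ℝ, 0 ≤ M ∧ v b ≤ M := by
  refine ⟨max 0 (v b).toReal, le_max_left _ _, ?_⟩
  exact (EReal.le_coe_toReal (hv.ne_top b)).trans (EReal.coe_le_coe_iff.2 (le_max_right _ _))

variable {S : Type*} [MeasurableSpace S]

lemma eintegral_mono (μ : Measure S) {f g : S → EReal} (h : ∀ θ, f θ ≤ g θ) :
    eintegral μ f ≤ eintegral μ g := by
  refine EReal.sub_le_sub ?_ ?_
  · exact EReal.coe_ennreal_le_coe_ennreal_iff.2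
      (lintegral_mono fun θ => EReal.toENNReal_le_toENNReal (h θ))
  · exact EReal.coe_ennreal_le_coe_ennreal_iff.2
      (lintegral_mono fun θ => EReal.toENNReal_le_toENNReal (EReal.neg_le_neg_iff.2 (h θ)))

lemma toENNReal_add_sub_toENNReal {M : ℝ} (hM : 0 ≤ M) {x : EReal} (hx : x ≤ M) :
    x.toENNReal + ((M : EReal) - x).toENNReal = ENNReal.ofReal M + (-x).toENNReal := by
  induction x with
  | bot => simp
  | top => simp at hx
  | coe x =>
    have hx' : x ≤ M := EReal.coe_le_coe_iff.1 hx
    rw [← EReal.coe_neg, ← EReal.coe_sub]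
    simp only [EReal.real_coe_toENNReal]
    rcases le_total 0 x with h | h
    · rw [ENNReal.ofReal_of_nonpos (neg_nonpos.2 h), add_zero,
        ← ENNReal.ofReal_add h (sub_nonneg.2 hx')]
      congr 1; ring
    · rw [ENNReal.ofReal_of_nonpos h, zero_add, ← ENNReal.ofReal_add hM (neg_nonneg.2 h)]
      congr 1

/-- All infinite values are collected in one nonnegative integral, the expected distance of `f` to
its bound. Convexity and Fatou's lemma can then be used in `ℝ≥0∞`, where ∞ - ∞ does not occur. -/
lemma eintegral_eq_sub (μ : Measure S) [IsProbabilityMeasure μ] {f : S → EReal}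
    (hf : Measurable f) {M : ℝ} (hM : 0 ≤ M) (hfM : ∀ θ, f θ ≤ M) :
    eintegral μ f = (M : EReal) - ((∫⁻ θ, ((M : EReal) - f θ).toENNReal ∂μ : ℝ≥0∞) : EReal) := by
  have h : (∫⁻ θ, (f θ).toENNReal ∂μ) + ∫⁻ θ, ((M : EReal) - f θ).toENNReal ∂μ
      = ENNReal.ofReal M + ∫⁻ θ, (-f θ).toENNReal ∂μ := by
    rw [← lintegral_add_left hf.ereal_toENNReal]
    simp_rw [toENNReal_add_sub_toENNReal hM (hfM _)]
    rw [lintegral_add_left measurable_const]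
    simp
  have hpos : (∫⁻ θ, (f θ).toENNReal ∂μ) ≠ ⊤ := by
    refine ne_top_of_le_ne_top ENNReal.ofReal_ne_top (b := ENNReal.ofReal M) ?_
    calc (∫⁻ θ, (f θ).toENNReal ∂μ) ≤ ∫⁻ _, ENNReal.ofReal M ∂μ := by
          refine lintegral_mono fun θ => ?_
          simpa using EReal.toENNReal_le_toENNReal (hfM θ)
      _ = ENNReal.ofReal M := by simp
  rw [eintegral]
  generalize (∫⁻ θ, (f θ).toENNReal ∂μ) = p at *
  generalize (∫⁻ θ, ((M : EReal) - f θ).toENNReal ∂μ) = d at *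
  generalize (∫⁻ θ, (-f θ).toENNReal ∂μ) = n at *
  lift p to ℝ≥0 using hpos
  by_cases hd : d = ⊤
  · have hn : n = ⊤ := by
      rw [hd, add_top] at h
      by_contra hn
      exact (ENNReal.add_ne_top.2 ⟨ENNReal.ofReal_ne_top, hn⟩) h.symm
    simp [hd, hn]
  · have hn : n ≠ ⊤ := by
      rintro rfl
      rw [add_top] at h
      exact (ENNReal.add_ne_top.2 ⟨ENNReal.coe_ne_top, hd⟩) h
    lift d to ℝ≥0 using hd
    lift n to ℝ≥0 using hn
    lift M to ℝ≥0 using hM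
    rw [ENNReal.ofReal_coe_nnreal] at h
    have h' : (p : ℝ) + d = M + n := by exact_mod_cast h
    simp only [EReal.coe_nnreal_eq_coe_real]
    rw [← EReal.coe_sub, ← EReal.coe_sub]
    congr 1
    linarith

lemma toENNReal_sub_combination_le {M : ℝ} {x y z : EReal} {a b : ℝ}
    (ha : 0 ≤ a) (hb : 0 ≤ b) (hab : a + b = 1) (hx : x ≤ M) (hy : y ≤ M)
    (h : (a : EReal) * x + (b : EReal) * y ≤ z) :
    ((M : EReal) - z).toENNReal ≤ ENNReal.ofReal a * ((M : EReal) - x).toENNReal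
      + ENNReal.ofReal b * ((M : EReal) - y).toENNReal := by
  -- Zero weights are split off because 0 · ∞ = 0. With positive weights an infinite distance makes
  -- the right side ⊤.
  rcases ha.eq_or_lt with rfl | ha
  · have hb1 : b = 1 := by linarith
    subst hb1
    simp only [EReal.coe_zero, zero_mul, EReal.coe_one, one_mul, zero_add] at h
    simpa using EReal.toENNReal_le_toENNReal (EReal.sub_le_sub (le_refl (M : EReal)) h)
  rcases hb.eq_or_lt with rfl | hb
  · have ha1 : a = 1 := by linarith
    subst ha1
    simp only [EReal.coe_zero, zero_mul, EReal.coe_one, one_mul, add_zero] at h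
    simpa using EReal.toENNReal_le_toENNReal (EReal.sub_le_sub (le_refl (M : EReal)) h)
  induction x with
  | bot => simp [ENNReal.mul_top, ha]
  | top => simp at hx
  | coe x =>
    induction y with
    | bot => simp [ENNReal.mul_top, hb]
    | top => simp at hy
    | coe y =>
      refine (EReal.toENNReal_le_toENNReal (EReal.sub_le_sub (le_refl (M : EReal)) h)).trans ?_
      have hx' : x ≤ M := EReal.coe_le_coe_iff.1 hx
      have hy' : y ≤ M := EReal.coe_le_coe_iff.1 hy
      have e : (M : EReal) - ((a : EReal) * x + (b : EReal) * y)
          = ((a * (M - x) + b * (M - y) : ℝ) : EReal) := by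
        rw [← EReal.coe_mul, ← EReal.coe_mul, ← EReal.coe_add, ← EReal.coe_sub]
        congr 1
        linear_combination (-M) * hab
      rw [e, ← EReal.coe_sub, ← EReal.coe_sub]
      simp only [EReal.real_coe_toENNReal]
      rw [ENNReal.ofReal_add (mul_nonneg ha.le (sub_nonneg.2 hx'))
        (mul_nonneg hb.le (sub_nonneg.2 hy')), ENNReal.ofReal_mul ha.le, ENNReal.ofReal_mul hb.le]

/-- Upper semicontinuity of `v`, expressed for the distance to an upper bound. -/
lemma toENNReal_sub_le_liminf {v : ℝ → EReal} (hv : IsUtility v) (M : ℝ) {x : ℝ} {xs : ℕ → ℝ}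
    (h : Tendsto xs atTop (𝓝 x)) :
    ((M : EReal) - v x).toENNReal ≤ liminf (fun n => ((M : EReal) - v (xs n)).toENNReal) atTop := by
  refine le_of_forall_lt fun c hc => ?_
  obtain ⟨c', hcc', hc'⟩ := exists_between hc
  refine lt_of_lt_of_le hcc' ?_
  refine le_liminf_of_le (by isBoundedDefault) ?_
  have hc'top : c' ≠ ⊤ := (lt_of_lt_of_le hc' le_top).ne
  have key : ∀ y : EReal, y ≠ ⊤ →
      ((c' < ((M : EReal) - y).toENNReal) ↔ y < ((M - c'.toReal : ℝ) : EReal)) := by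
    intro y hy
    lift c' to ℝ≥0 using hc'top
    induction y with
    | bot =>
      rw [EReal.coe_sub_bot, EReal.toENNReal_top]
      simp only [ENNReal.coe_lt_top, true_iff]
      exact EReal.bot_lt_coe _
    | top => exact absurd rfl hy
    | coe y =>
      rw [← EReal.coe_sub, EReal.real_coe_toENNReal, EReal.coe_lt_coe_iff, ENNReal.coe_toReal,
        ENNReal.lt_ofReal_iff_toReal_lt ENNReal.coe_ne_top, ENNReal.coe_toReal]
      constructor <;> intro h <;> linarith
  have h1 := (key _ (hv.ne_top x)).1 hc'
  filter_upwards [h.eventually (hv.usc x _ h1)] with n hn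
  exact ((key _ (hv.ne_top _)).2 hn).le

lemma certaintyEquiv_mono {v : ℝ → EReal} (hv : IsUtility v) (μ₀ : ProbabilityMeasure S)
    {X Z : S → ℝ} (h : X ≤ Z) : certaintyEquiv μ₀ v X ≤ certaintyEquiv μ₀ v Z := by
  refine (le_genInverse_iff hv.mono).2 ?_
  intro m hm
  exact ((le_genInverse_iff hv.mono).1 le_rfl m hm).trans
    (eintegral_mono _ fun θ => hv.mono (h θ))

variable [TopologicalSpace S]

lemma IsUtility.comp_le {S : Type*} [TopologicalSpace S] [CompactSpace S] {v : ℝ → EReal}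
    (hv : IsUtility v) (X : C(S, ℝ)) {b : ℝ} (hX : ‖X‖ ≤ b) (θ : S) : v (X θ) ≤ v b :=
  hv.mono ((le_abs_self _).trans ((X.norm_coe_le_norm θ).trans hX))

/-- Convexity and closedness pass through intersections, so they need only be shown for expected
utility; no regularity of the generalised inverse is required. -/
lemma setOf_le_certaintyEquiv {v : ℝ → EReal} (hv : IsUtility v) (μ₀ : ProbabilityMeasure S)
    (α : EReal) :
    {X : C(S, ℝ) | α ≤ certaintyEquiv μ₀ v X} =
      ⋂ (m : ℝ) (_ : (m : EReal) < α),
        {X : C(S, ℝ) | v m ≤ eintegral (μ₀ : Measure S) fun θ => v (X θ)} := by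
  ext X
  simp [certaintyEquiv, le_genInverse_iff hv.mono]

variable [BorelSpace S]

lemma IsUtility.measurable_comp {v : ℝ → EReal} (hv : IsUtility v) (X : C(S, ℝ)) :
    Measurable fun θ => v (X θ) :=
  hv.mono.measurable.comp X.continuous.measurable

variable [CompactSpace S]

lemma convex_setOf_le_eintegral {v : ℝ → EReal} (hv : IsUtility v) (μ : Measure S)
    [IsProbabilityMeasure μ] (y : EReal) :
    Convex ℝ {X : C(S, ℝ) | y ≤ eintegral μ fun θ => v (X θ)} := by
  intro X hX Z hZ a b ha hb hab
  obtain ⟨M, hM, hvM⟩ := exists_nonneg_upper_bound hv (max (max ‖X‖ ‖Z‖) ‖a • X + b • Z‖)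
  have bX : ∀ θ, v (X θ) ≤ M := fun θ =>
    (hv.comp_le X ((le_max_left _ _).trans (le_max_left _ _)) θ).trans hvM
  have bZ : ∀ θ, v (Z θ) ≤ M := fun θ =>
    (hv.comp_le Z ((le_max_right _ _).trans (le_max_left _ _)) θ).trans hvM
  have bW : ∀ θ, v ((a • X + b • Z) θ) ≤ M := fun θ =>
    (hv.comp_le _ (le_max_right _ _) θ).trans hvM
  simp only [Set.mem_ofPred_eq] at hX hZ ⊢
  rw [eintegral_eq_sub μ (hv.measurable_comp X) hM bX] at hX
  rw [eintegral_eq_sub μ (hv.measurable_comp Z) hM bZ] at hZ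
  rw [eintegral_eq_sub μ (hv.measurable_comp _) hM bW]
  set dX := ∫⁻ θ, ((M : EReal) - v (X θ)).toENNReal ∂μ
  set dZ := ∫⁻ θ, ((M : EReal) - v (Z θ)).toENNReal ∂μ
  have hle : ∫⁻ θ, ((M : EReal) - v ((a • X + b • Z) θ)).toENNReal ∂μ ≤ max dX dZ := by
    calc ∫⁻ θ, ((M : EReal) - v ((a • X + b • Z) θ)).toENNReal ∂μ
        ≤ ∫⁻ θ, (ENNReal.ofReal a * ((M : EReal) - v (X θ)).toENNReal
            + ENNReal.ofReal b * ((M : EReal) - v (Z θ)).toENNReal) ∂μ :=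
          lintegral_mono fun θ => toENNReal_sub_combination_le ha hb hab (bX θ) (bZ θ)
            (hv.concave _ _ _ _ ha hb hab)
      _ = ENNReal.ofReal a * dX + ENNReal.ofReal b * dZ := by
          have mX : Measurable fun θ => ((M : EReal) - v (X θ)).toENNReal :=
            (measurable_const.sub (hv.measurable_comp X)).ereal_toENNReal
          have mZ : Measurable fun θ => ((M : EReal) - v (Z θ)).toENNReal :=
            (measurable_const.sub (hv.measurable_comp Z)).ereal_toENNReal
          rw [lintegral_add_left (mX.const_mul _), lintegral_const_mul _ mX,
            lintegral_const_mul _ mZ]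
      _ ≤ ENNReal.ofReal a * max dX dZ + ENNReal.ofReal b * max dX dZ := by
          gcongr
          · exact le_max_left _ _
          · exact le_max_right _ _
      _ = max dX dZ := by
          rw [← add_mul, ← ENNReal.ofReal_add ha hb, hab, ENNReal.ofReal_one, one_mul]
  have hmax : y ≤ (M : EReal) - ((max dX dZ : ℝ≥0∞) : EReal) := by
    rcases max_cases dX dZ with h | h <;> rw [h.1] <;> assumption
  exact hmax.trans (EReal.sub_le_sub le_rfl (EReal.coe_ennreal_le_coe_ennreal_iff.2 hle))

/-- A convergent sequence is bounded in sup norm, so one `M` bounds all the utilities; Fatou's lemma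
then applies to the distances `M - v (Xs n)`. -/
lemma isClosed_setOf_le_eintegral {v : ℝ → EReal} (hv : IsUtility v) (μ : Measure S)
    [IsProbabilityMeasure μ] (y : EReal) :
    IsClosed {X : C(S, ℝ) | y ≤ eintegral μ fun θ => v (X θ)} := by
  refine IsSeqClosed.isClosed fun Xs X hXs hlim => ?_
  obtain ⟨B, hB⟩ := (hlim.norm.isBoundedUnder_le).bddAbove_range
  have hXB : ‖X‖ ≤ B := le_of_tendsto hlim.norm (Eventually.of_forall fun n => hB ⟨n, rfl⟩)
  obtain ⟨M, hM, hvM⟩ := exists_nonneg_upper_bound hv B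
  have bX : ∀ θ, v (X θ) ≤ M := fun θ => (hv.comp_le X hXB θ).trans hvM
  have bXs : ∀ n θ, v (Xs n θ) ≤ M := fun n θ => (hv.comp_le (Xs n) (hB ⟨n, rfl⟩) θ).trans hvM
  simp only [Set.mem_ofPred_eq] at hXs ⊢
  -- Exchanging `d` and `y` is legitimate even for infinite values, since `M` is finite and `d ≥ 0`.
  have conv : ∀ d : ℝ≥0∞, y ≤ (M : EReal) - (d : EReal) ↔ (d : EReal) ≤ (M : EReal) - y := by
    intro d
    induction y with
    | bot => simp
    | top =>
      simp only [top_le_iff, EReal.sub_top, le_bot_iff, EReal.coe_ennreal_ne_bot, iff_false]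
      induction d with
      | top => simp
      | coe d =>
        rw [EReal.coe_nnreal_eq_coe_real, ← EReal.coe_sub]
        exact EReal.coe_ne_top _
    | coe y =>
      rw [EReal.le_sub_iff_add_le (by simp) (by simp), EReal.le_sub_iff_add_le (by simp) (by simp),
        add_comm]
  have hd : ∀ n, ∫⁻ θ, ((M : EReal) - v (Xs n θ)).toENNReal ∂μ ≤ ((M : EReal) - y).toENNReal := by
    intro n
    have := hXs n
    rw [eintegral_eq_sub μ (hv.measurable_comp _) hM (bXs n), conv] at this
    simpa using EReal.toENNReal_le_toENNReal this
  have hy : 0 ≤ (M : EReal) - y := by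
    have := hXs 0
    rw [eintegral_eq_sub μ (hv.measurable_comp _) hM (bXs 0), conv] at this
    exact (EReal.coe_ennreal_nonneg _).trans this
  rw [eintegral_eq_sub μ (hv.measurable_comp _) hM bX, conv, ← EReal.coe_toENNReal hy,
    EReal.coe_ennreal_le_coe_ennreal_iff]
  calc ∫⁻ θ, ((M : EReal) - v (X θ)).toENNReal ∂μ
      ≤ ∫⁻ θ, liminf (fun n => ((M : EReal) - v (Xs n θ)).toENNReal) atTop ∂μ :=
        lintegral_mono fun θ => toENNReal_sub_le_liminf hv M
          (((continuous_eval_const θ).tendsto X).comp hlim)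
    _ ≤ liminf (fun n => ∫⁻ θ, ((M : EReal) - v (Xs n θ)).toENNReal ∂μ) atTop :=
        lintegral_liminf_le fun n =>
          (measurable_const.sub (hv.measurable_comp (Xs n))).ereal_toENNReal
    _ ≤ ((M : EReal) - y).toENNReal :=
        liminf_le_of_frequently_le' (Frequently.of_forall hd)

lemma convex_setOf_le_certaintyEquiv {v : ℝ → EReal} (hv : IsUtility v)
    (μ₀ : ProbabilityMeasure S) (α : EReal) :
    Convex ℝ {X : C(S, ℝ) | α ≤ certaintyEquiv μ₀ v X} := by
  rw [setOf_le_certaintyEquiv hv]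
  exact convex_iInter₂ fun m _ => convex_setOf_le_eintegral hv _ _

lemma isClosed_setOf_le_certaintyEquiv {v : ℝ → EReal} (hv : IsUtility v)
    (μ₀ : ProbabilityMeasure S) (α : EReal) :
    IsClosed {X : C(S, ℝ) | α ≤ certaintyEquiv μ₀ v X} := by
  rw [setOf_le_certaintyEquiv hv]
  exact isClosed_biInter fun m _ => isClosed_setOf_le_eintegral hv _ _

end CertaintyEquivalent

/-! ### Separation by probability measures -/

section Duality

variable {S : Type*} [TopologicalSpace S] [CompactSpace S] [MeasurableSpace S] [BorelSpace S]

lemma integrable_continuousMap (Q : Measure S) [IsFiniteMeasure Q] (X : C(S, ℝ)) :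
    Integrable X Q :=
  (BoundedContinuousFunction.mkOfCompact X).integrable Q

lemma continuous_integral_continuousMap (X : C(S, ℝ)) :
    Continuous fun Q : ProbabilityMeasure S => ∫ θ, X θ ∂(Q : Measure S) :=
  ProbabilityMeasure.continuous_integral_boundedContinuousFunction
    (BoundedContinuousFunction.mkOfCompact X)

lemma abs_integral_sub_le (Q : ProbabilityMeasure S) (X Z : C(S, ℝ)) :
    |∫ θ, X θ ∂(Q : Measure S) - ∫ θ, Z θ ∂(Q : Measure S)| ≤ ‖X - Z‖ := by
  rw [← integral_sub (integrable_continuousMap _ X) (integrable_continuousMap _ Z)]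
  have h := norm_integral_le_of_norm_le_const (μ := (Q : Measure S))
    (Eventually.of_forall fun θ => (X - Z).norm_coe_le_norm θ)
  simpa using h

lemma integral_of_eq_smul_add {Q Q₁ Q₂ : ProbabilityMeasure S} {a b : ℝ≥0}
    (hQ : (Q : Measure S) = a • (Q₁ : Measure S) + b • (Q₂ : Measure S)) (X : C(S, ℝ)) :
    ∫ θ, X θ ∂(Q : Measure S)
      = a * ∫ θ, X θ ∂(Q₁ : Measure S) + b * ∫ θ, X θ ∂(Q₂ : Measure S) := by
  rw [hQ, integral_add_measure ((integrable_continuousMap _ X).smul_measure_nnreal)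
    ((integrable_continuousMap _ X).smul_measure_nnreal), integral_smul_nnreal_measure,
    integral_smul_nnreal_measure]
  rfl

variable [T2Space S]

/-- A normalised positive linear functional on `C(S)` is the expectation under a probability
measure. -/
lemma exists_probabilityMeasure_integral_eq (Λ : C(S, ℝ) →ₗ[ℝ] ℝ) (hpos : ∀ X, 0 ≤ X → 0 ≤ Λ X)
    (hone : Λ 1 = 1) :
    ∃ Q : ProbabilityMeasure S, ∀ X : C(S, ℝ), ∫ θ, X θ ∂(Q : Measure S) = Λ X := by
  let Λ' : CompactlySupportedContinuousMap S ℝ →ₚ[ℝ] ℝ := PositiveLinearMap.mk₀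
    { toFun := fun f => Λ f.toContinuousMap
      map_add' := fun f g => Λ.map_add f.toContinuousMap g.toContinuousMap
      map_smul' := fun c f => Λ.map_smul c f.toContinuousMap }
    (fun f hf => hpos _ hf)
  have hint : ∀ X : C(S, ℝ), ∫ θ, X θ ∂(RealRMK.rieszMeasure Λ') = Λ X := fun X =>
    RealRMK.integral_rieszMeasure Λ' (CompactlySupportedContinuousMap.continuousMapEquiv X)
  have huniv : IsProbabilityMeasure (RealRMK.rieszMeasure Λ') := by
    have h1 := hint 1
    rw [hone] at h1
    simp only [ContinuousMap.one_apply, integral_const, smul_eq_mul, mul_one] at h1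
    constructor
    rw [measureReal_def] at h1
    exact (ENNReal.toReal_eq_one_iff _).1 h1
  exact ⟨⟨_, huniv⟩, hint⟩

/-- A point outside a closed convex upward closed set of continuous functions is separated from
the set by the expectation under a probability measure. -/
lemma exists_probabilityMeasure_separating {C : Set C(S, ℝ)} (hconv : Convex ℝ C)
    (hclosed : IsClosed C) (hup : ∀ X ∈ C, ∀ Z, X ≤ Z → Z ∈ C) (hne : C.Nonempty)
    {X : C(S, ℝ)} (hX : X ∉ C) :
    ∃ (Q : ProbabilityMeasure S) (u : ℝ), ∫ θ, X θ ∂(Q : Measure S) < u ∧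
      ∀ Z ∈ C, u < ∫ θ, Z θ ∂(Q : Measure S) := by
  obtain ⟨f, u, hfX, hfC⟩ := geometric_hahn_banach_point_closed hconv hclosed hX
  obtain ⟨Z₀, hZ₀⟩ := hne
  have hpos : ∀ H : C(S, ℝ), 0 ≤ H → 0 ≤ f H := by
    intro H hH
    by_contra hneg
    push Not at hneg
    -- If `f H < 0`, moving from `Z₀` far enough in the direction `H` stays in `C` but pushes `f`
    -- below `u`.
    obtain ⟨n, hn⟩ := exists_nat_gt ((f Z₀ - u) / (-f H))
    rw [div_lt_iff₀ (by linarith)] at hn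
    have h1 := hfC (Z₀ + (n : ℝ) • H)
      (hup _ hZ₀ _ (le_add_of_nonneg_right (smul_nonneg n.cast_nonneg hH)))
    rw [map_add, map_smul, smul_eq_mul] at h1
    nlinarith
  have habs : ∀ H : C(S, ℝ), f H ≤ ‖H‖ * f 1 := by
    intro H
    have h1 := hpos (‖H‖ • (1 : C(S, ℝ)) - H) (by
      intro θ
      simpa using (le_abs_self _).trans (H.norm_coe_le_norm θ))
    rw [map_sub, map_smul, smul_eq_mul] at h1
    linarith
  -- If `f 1 = 0`, the previous bound gives `f (Z₀ - X) ≤ 0`, against strict separation.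
  have hone : 0 < f 1 := by
    refine lt_of_le_of_ne (hpos 1 zero_le_one) fun h0 => ?_
    have h1 := habs (Z₀ - X)
    have h2 := hfC Z₀ hZ₀
    rw [map_sub, ← h0, mul_zero] at h1
    linarith
  obtain ⟨Q, hQ⟩ := exists_probabilityMeasure_integral_eq ((f 1)⁻¹ • (f : C(S, ℝ) →ₗ[ℝ] ℝ))
    (fun H hH => mul_nonneg (inv_nonneg.2 hone.le) (hpos H hH)) (inv_mul_cancel₀ hone.ne')
  have hQ' : ∀ H : C(S, ℝ), ∫ θ, H θ ∂(Q : Measure S) = (f 1)⁻¹ * f H := hQ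
  refine ⟨Q, (f 1)⁻¹ * u, ?_, fun Z hZ => ?_⟩
  · rw [hQ']; exact mul_lt_mul_of_pos_left hfX (inv_pos.2 hone)
  · rw [hQ']; exact mul_lt_mul_of_pos_left (hfC Z hZ) (inv_pos.2 hone)

end Duality

/-! ### The explicit dual function -/

section DualFunction

variable {S : Type*} [MetricSpace S] [MeasurableSpace S]
  {μ₀ : ProbabilityMeasure S} {v : ℝ → EReal}

/-- The slack `s' > s` comes from the right-continuous version, the slack `c' < c` from a supremum
that need not be attained. -/
lemma dualFunction_lt_iff {Q : ProbabilityMeasure S} {s : ℝ} {c : EReal} :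
    dualFunction μ₀ v Q s < c ↔ ∃ s' > s, ∃ c' < c, ∀ X : C(S, ℝ),
      ∫ θ, X θ ∂(Q : Measure S) ≤ s' → certaintyEquiv μ₀ v X ≤ c' := by
  simp only [dualFunction, iInf_lt_iff]
  constructor
  · rintro ⟨⟨s', hs'⟩, h⟩
    exact ⟨s', hs', _, h, fun X hX => le_iSup_of_le
      (f := fun X : {X : C(S, ℝ) // ∫ θ, X θ ∂(Q : Measure S) ≤ s'} => certaintyEquiv μ₀ v X.1)
      ⟨X, hX⟩ le_rfl⟩
  · rintro ⟨s', hs', c', hc', h⟩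
    have hle : ⨆ X : {X : C(S, ℝ) // ∫ θ, X θ ∂(Q : Measure S) ≤ s'}, certaintyEquiv μ₀ v X.1
        ≤ c' := iSup_le fun X => h X.1 X.2
    exact ⟨⟨s', hs'⟩, lt_of_le_of_lt hle hc'⟩

lemma certaintyEquiv_le_dualFunction (Q : ProbabilityMeasure S) {X : C(S, ℝ)} {s : ℝ}
    (h : ∫ θ, X θ ∂(Q : Measure S) ≤ s) : certaintyEquiv μ₀ v X ≤ dualFunction μ₀ v Q s :=
  le_iInf fun s' => le_iSup_of_le
    (f := fun X : {X : C(S, ℝ) // ∫ θ, X θ ∂(Q : Measure S) ≤ s'} => certaintyEquiv μ₀ v X.1)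
    ⟨X, h.trans (le_of_lt s'.2)⟩ le_rfl

lemma monotone_dualFunction (Q : ProbabilityMeasure S) : Monotone (dualFunction μ₀ v Q) := by
  intro s t hst
  refine le_of_forall_gt fun c hc => ?_
  rw [dualFunction_lt_iff] at hc ⊢
  obtain ⟨s', hs', h⟩ := hc
  exact ⟨s', hst.trans_lt hs', h⟩

lemma exists_lt_of_lt_dualFunction {Q : ProbabilityMeasure S} {s s' : ℝ} (hs : s < s') {c : EReal}
    (hc : c < dualFunction μ₀ v Q s) :
    ∃ X : C(S, ℝ), ∫ θ, X θ ∂(Q : Measure S) ≤ s' ∧ c < certaintyEquiv μ₀ v X := by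
  by_contra! h
  obtain ⟨c', hcc', hc'⟩ := exists_between hc
  exact hc'.not_ge (dualFunction_lt_iff.2 ⟨s', hs, c, hcc', h⟩).le

/-- For fixed `X` the condition on the right is open in `Q`; this is the source of lower
semicontinuity. -/
lemma lt_iSup_dualFunction_iff {Q : ProbabilityMeasure S} {s : ℝ} {c : EReal} :
    c < ⨆ s' : Set.Iio s, dualFunction μ₀ v Q s' ↔
      ∃ X : C(S, ℝ), c < certaintyEquiv μ₀ v X ∧ ∫ θ, X θ ∂(Q : Measure S) < s := by
  rw [lt_iSup_iff]
  constructor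
  · rintro ⟨⟨s', hs'⟩, h⟩
    obtain ⟨s'', h1, h2⟩ := exists_between (show s' < s from hs')
    obtain ⟨X, hX, hcX⟩ := exists_lt_of_lt_dualFunction h1 h
    exact ⟨X, hcX, hX.trans_lt h2⟩
  · rintro ⟨X, hcX, hX⟩
    exact ⟨⟨_, hX⟩, hcX.trans_le (certaintyEquiv_le_dualFunction Q le_rfl)⟩

variable [CompactSpace S] [BorelSpace S]

/-- If U(X) < α, a measure separating `X` from {α ≤ U} has U < α on a half-space {∫ Z dQ ≤ u} with u
> ∫ X dQ, which bounds the dual function at `Q`. -/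
lemma iInf_dualFunction_le (hv : IsUtility v) (X : C(S, ℝ)) :
    ⨅ Q : ProbabilityMeasure S, dualFunction μ₀ v Q (∫ θ, X θ ∂(Q : Measure S))
      ≤ certaintyEquiv μ₀ v X := by
  refine le_of_forall_gt fun c hc => ?_
  obtain ⟨α, hα, hαc⟩ := exists_between hc
  rw [iInf_lt_iff]
  simp_rw [dualFunction_lt_iff]
  rcases Set.eq_empty_or_nonempty {Z : C(S, ℝ) | α ≤ certaintyEquiv μ₀ v Z} with hemp | hne
  -- Nothing has to be separated here, so any measure serves.
  · refine ⟨μ₀, _, lt_add_one _, α, hαc, fun Z _ => ?_⟩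
    by_contra! hZ
    exact (Set.eq_empty_iff_forall_notMem.1 hemp Z) hZ.le
  · obtain ⟨Q, u, hu, hsep⟩ := exists_probabilityMeasure_separating
      (convex_setOf_le_certaintyEquiv hv μ₀ α) (isClosed_setOf_le_certaintyEquiv hv μ₀ α)
      (fun Z hZ W hZW => le_trans hZ (certaintyEquiv_mono hv μ₀ hZW)) hne (X := X) (not_le.2 hα)
    refine ⟨Q, u, hu, α, hαc, fun Z hZ => ?_⟩
    by_contra! hαZ
    exact (hsep Z hαZ.le).not_ge hZ

theorem isDualFunction_dualFunction (hv : IsUtility v) :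
    IsDualFunction μ₀ v (dualFunction μ₀ v) where
  represents X := le_antisymm (le_iInf fun Q => certaintyEquiv_le_dualFunction Q le_rfl)
    (iInf_dualFunction_le hv X)
  mono := monotone_dualFunction
  rightContinuous Q s := by
    refine tendsto_order.2 ⟨fun c hc => ?_, fun c hc => ?_⟩
    · filter_upwards [self_mem_nhdsWithin] with t ht
      exact hc.trans_le (monotone_dualFunction Q ht)
    · obtain ⟨s', hs', h⟩ := dualFunction_lt_iff.1 hc
      filter_upwards [mem_nhdsWithin_of_mem_nhds (Iio_mem_nhds hs')] with t ht
      exact dualFunction_lt_iff.2 ⟨s', ht, h⟩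
  quasiconvex Q₁ Q₂ Q s₁ s₂ a b hab hQ := by
    refine le_of_forall_gt fun c hc => ?_
    obtain ⟨h1, h2⟩ := max_lt_iff.1 hc
    obtain ⟨t₁, ht₁, c₁, hc₁, h1⟩ := dualFunction_lt_iff.1 h1
    obtain ⟨t₂, ht₂, c₂, hc₂, h2⟩ := dualFunction_lt_iff.1 h2
    have hab' : (a : ℝ) + b = 1 := by exact_mod_cast hab
    refine dualFunction_lt_iff.2 ⟨a * t₁ + b * t₂, ?_, max c₁ c₂, max_lt hc₁ hc₂, fun X hX => ?_⟩
    · rcases eq_or_ne a 0 with rfl | ha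
      · have : (b : ℝ) = 1 := by simpa using hab'
        simpa [this] using ht₂
      · have ha' : (0 : ℝ) < a := by positivity
        have := mul_lt_mul_of_pos_left ht₁ ha'
        have := mul_le_mul_of_nonneg_left (le_of_lt ht₂) b.coe_nonneg
        change (a : ℝ) * s₁ + b * s₂ < _
        linarith
    · rw [integral_of_eq_smul_add hQ] at hX
      -- The mixed constraint forces at least one of the two constraints ∫ X dQᵢ ≤ tᵢ.
      by_cases h : ∫ θ, X θ ∂(Q₁ : Measure S) ≤ t₁
      · exact (h1 X h).trans (le_max_left _ _)
      · refine (h2 X ?_).trans (le_max_right _ _)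
        by_contra! h'
        push Not at h
        rcases eq_or_ne a 0 with rfl | ha
        · have : (b : ℝ) = 1 := by simpa using hab'
          simp only [NNReal.coe_zero, zero_mul, this, one_mul, zero_add] at hX
          linarith
        · have ha' : (0 : ℝ) < a := by positivity
          have := mul_lt_mul_of_pos_left h ha'
          have := mul_le_mul_of_nonneg_left h'.le b.coe_nonneg
          linarith
  limit := by
    refine ⟨⨆ X : C(S, ℝ), certaintyEquiv μ₀ v X, fun Q => ?_⟩
    -- Every `X` becomes admissible for large `s`, so the limit is the supremum of U over C(S),
    -- whatever `Q` is.
    have h : ⨆ X : C(S, ℝ), certaintyEquiv μ₀ v X = ⨆ s, dualFunction μ₀ v Q s := by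
      refine le_antisymm (iSup_le fun X => le_iSup_of_le _
        (certaintyEquiv_le_dualFunction Q le_rfl)) (iSup_le fun s => ?_)
      refine iInf_le_of_le ⟨s + 1, lt_add_one s⟩ (iSup_le fun X => ?_)
      exact le_iSup (fun X : C(S, ℝ) => certaintyEquiv μ₀ v X) X.1
    rw [h]
    exact tendsto_atTop_iSup (monotone_dualFunction Q)
  lsc s Q c hc := by
    obtain ⟨X, hcX, hX⟩ := lt_iSup_dualFunction_iff.1 hc
    filter_upwards [(continuous_integral_continuousMap X).tendsto Q (Iio_mem_nhds hX)] with Q' hQ'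
    exact lt_iSup_dualFunction_iff.2 ⟨X, hcX, hQ'⟩

end DualFunction

/-- The convex combination of two probability measures. -/
lemma exists_probabilityMeasure_eq_smul_add {S : Type*} [MeasurableSpace S]
    (Q₁ Q₂ : ProbabilityMeasure S) {a b : ℝ≥0}
    (hab : a + b = 1) :
    ∃ Q : ProbabilityMeasure S, (Q : Measure S) = a • (Q₁ : Measure S) + b • (Q₂ : Measure S) := by
  refine ⟨⟨a • (Q₁ : Measure S) + b • (Q₂ : Measure S), ⟨?_⟩⟩, rfl⟩
  rw [Measure.add_apply, Measure.coe_nnreal_smul_apply, Measure.coe_nnreal_smul_apply,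
    measure_univ, measure_univ, mul_one, mul_one]
  exact_mod_cast hab

/-! ### Probability measures inside the weak dual of C(S) -/

section WeakDualEmbedding

variable {S : Type*} [TopologicalSpace S] [CompactSpace S] [MeasurableSpace S] [BorelSpace S]

/-- A probability measure on a compact space, as a functional on the continuous functions. -/
noncomputable def expectationFunctional (Q : ProbabilityMeasure S) : WeakDual ℝ C(S, ℝ) :=
  StrongDual.toWeakDual <| LinearMap.mkContinuous
    { toFun := fun X : C(S, ℝ) => ∫ θ, X θ ∂(Q : Measure S)
      map_add' := fun X Z => integral_add (integrable_continuousMap _ X)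
        (integrable_continuousMap _ Z)
      map_smul' := fun c X => integral_const_mul c _ } 1
    (fun X => by
      rw [one_mul]
      simpa using abs_integral_sub_le Q X 0)

@[simp] lemma expectationFunctional_apply (Q : ProbabilityMeasure S) (X : C(S, ℝ)) :
    expectationFunctional Q X = ∫ θ, X θ ∂(Q : Measure S) := rfl

lemma continuous_expectationFunctional :
    Continuous (expectationFunctional : ProbabilityMeasure S → WeakDual ℝ C(S, ℝ)) :=
  WeakDual.continuous_of_continuous_eval continuous_integral_continuousMap

lemma injective_expectationFunctional [HasOuterApproxClosed S] :
    Function.Injective (expectationFunctional : ProbabilityMeasure S → WeakDual ℝ C(S, ℝ)) := by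
  intro Q₁ Q₂ h
  have hQ : (Q₁ : Measure S) = Q₂ := by
    refine ext_of_forall_integral_eq_of_IsFiniteMeasure fun f => ?_
    exact DFunLike.congr_fun h f.toContinuousMap
  exact Subtype.ext hQ

end WeakDualEmbedding

/-! ### Minimax over sets of continuous functions -/

section Minimax

variable {S : Type*} [MetricSpace S] [MeasurableSpace S] [BorelSpace S]
  {μ₀ : ProbabilityMeasure S} {v : ℝ → EReal} {R : ProbabilityMeasure S → ℝ → EReal}

lemma exists_gt_lt_of_rightContinuous {f : ℝ → EReal} {s : ℝ}
    (h : ContinuousWithinAt f (Set.Ici s) s) {c : EReal} (hc : f s < c) :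
    ∃ t > s, f t < c := by
  have h1 : ∀ᶠ t in 𝓝[>] s, f t < c :=
    (h.mono Set.Ioi_subset_Ici_self).eventually (gt_mem_nhds hc)
  obtain ⟨t, ht, hts⟩ := (h1.and self_mem_nhdsWithin).exists
  exact ⟨t, hts, ht⟩

lemma exists_lt_lt_of_continuousAt {f : ℝ → EReal} {s : ℝ} (h : ContinuousAt f s) {c : EReal}
    (hc : c < f s) : ∃ t < s, c < f t := by
  have h1 : ∀ᶠ t in 𝓝[<] s, c < f t :=
    (h.continuousWithinAt (s := Set.Iio s)).eventually (lt_mem_nhds hc)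
  obtain ⟨t, ht, hts⟩ := (h1.and self_mem_nhdsWithin).exists
  exact ⟨t, hts, ht⟩

/-- Where `R` is continuous in its second argument, it is jointly lower semicontinuous. -/
lemma IsDualFunction.exists_lt_eventually (hR : IsDualFunction μ₀ v R) {Q : ProbabilityMeasure S}
    {s : ℝ} (hcont : ContinuousAt (R Q) s) {c : EReal} (hc : c < R Q s) :
    ∃ t < s, ∀ᶠ Q' in 𝓝 Q, c < R Q' t := by
  obtain ⟨r, hr, hcr⟩ := exists_lt_lt_of_continuousAt hcont hc
  -- The lower semicontinuous object is the supremum over arguments below `t`; `r` witnesses its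
  -- size at `Q`, and monotonicity returns to the value at `t` for nearby measures.
  obtain ⟨t, hrt, hts⟩ := exists_between hr
  refine ⟨t, hts, ?_⟩
  have h1 : c < ⨆ s' : Set.Iio t, R Q s' := lt_iSup_iff.2 ⟨⟨r, hrt⟩, hcr⟩
  filter_upwards [hR.lsc t Q c h1] with Q' hQ'
  exact hQ'.trans_le (iSup_le fun s' => hR.mono Q' (le_of_lt s'.2))

variable [CompactSpace S]

/-- At z.2 = 0 this is the semicontinuity in `Q` needed for Sion's theorem. The extra room z.2
allows for a perturbation of `X`. -/
lemma IsDualFunction.eventually_lt (hR : IsDualFunction μ₀ v R) {Q : ProbabilityMeasure S}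
    {X : C(S, ℝ)} (hcont : ContinuousAt (R Q) (∫ θ, X θ ∂(Q : Measure S))) {c : EReal}
    (hc : c < R Q (∫ θ, X θ ∂(Q : Measure S))) :
    ∀ᶠ z : ProbabilityMeasure S × ℝ in 𝓝 (Q, 0),
      c < R z.1 (∫ θ, X θ ∂(z.1 : Measure S) - z.2) := by
  obtain ⟨t, ht, hev⟩ := hR.exists_lt_eventually hcont hc
  have hcts : Continuous fun z : ProbabilityMeasure S × ℝ => ∫ θ, X θ ∂(z.1 : Measure S) - z.2 :=
    ((continuous_integral_continuousMap X).comp continuous_fst).sub continuous_snd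
  have h1 := hcts.continuousAt.eventually
    (lt_mem_nhds (show t < ∫ θ, X θ ∂((Q, (0 : ℝ)).1 : Measure S) - (Q, (0 : ℝ)).2 by simpa using ht))
  filter_upwards [h1, continuousAt_fst.eventually hev] with z hz hz'
  exact hz'.trans_le (hR.mono _ hz.le)

/-- The certainty equivalent is lower semicontinuous at `X` if the dual function is continuous in
its second argument at all expectations of `X`. -/
lemma IsDualFunction.exists_pos_forall_le (hR : IsDualFunction μ₀ v R) {X : C(S, ℝ)}
    (hcont : ∀ Q, ContinuousAt (R Q) (∫ θ, X θ ∂(Q : Measure S))) {c : EReal}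
    (hc : c < certaintyEquiv μ₀ v X) :
    ∃ ε > 0, ∀ Z : C(S, ℝ), ‖X - Z‖ < ε → c ≤ certaintyEquiv μ₀ v Z := by
  have hc' : ∀ Q, c < R Q (∫ θ, X θ ∂(Q : Measure S)) := fun Q => by
    rw [hR.represents] at hc
    exact hc.trans_le (iInf_le _ Q)
  -- Compactness of the space of probability measures gives one `ε` for all `Q`.
  have h := (isCompact_univ (X := ProbabilityMeasure S)).eventually_forall_of_forall_eventually
    (x₀ := (0 : ℝ)) (P := fun ε Q => c < R Q (∫ θ, X θ ∂(Q : Measure S) - ε))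
    (fun Q _ => by
      have := hR.eventually_lt (hcont Q) (hc' Q)
      exact (continuous_swap.tendsto ((0 : ℝ), Q)).eventually this)
  obtain ⟨ε, hε, hball⟩ := Metric.eventually_nhds_iff.1 h
  refine ⟨ε / 2, half_pos hε, fun Z hZ => ?_⟩
  rw [hR.represents]
  refine le_iInf fun Q => ?_
  refine (hball (y := ε / 2) ?_ Q trivial).le.trans (hR.mono Q ?_)
  · rw [Real.dist_eq, sub_zero, abs_of_pos (half_pos hε)]; linarith
  · have := (abs_sub_lt_iff.1 ((abs_integral_sub_le Q X Z).trans_lt hZ)).1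
    linarith

/-- In `X`, R(Q, ∫ X dQ) is a monotone function of a linear functional, hence quasi-concave, and
right-continuity makes it upper semicontinuous. In `Q`, quasi-convexity is part of the definition
and lower semicontinuity follows from `hcont`. So Sion's theorem applies. -/
theorem IsDualFunction.iInf_iSup_eq_iSup_certaintyEquiv (hR : IsDualFunction μ₀ v R)
    {C : Set C(S, ℝ)} (hC : Convex ℝ C)
    (hcont : ∀ X ∈ C, ∀ Q, ContinuousAt (R Q) (∫ θ, X θ ∂(Q : Measure S))) :
    ⨅ Q : ProbabilityMeasure S, ⨆ X ∈ C, R Q (∫ θ, X θ ∂(Q : Measure S))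
      = ⨆ X ∈ C, certaintyEquiv μ₀ v X := by
  have hemb : IsClosedEmbedding
      (expectationFunctional : ProbabilityMeasure S → WeakDual ℝ C(S, ℝ)) :=
    continuous_expectationFunctional.isClosedEmbedding injective_expectationFunctional
  have : Nonempty (ProbabilityMeasure S) := ⟨μ₀⟩
  -- Sion's theorem needs a topological vector space, while `R` lives on probability measures; `inv`
  -- matters only on the range of the embedding.
  let inv : WeakDual ℝ C(S, ℝ) → ProbabilityMeasure S := Function.invFun expectationFunctional
  have hinv : ∀ Q, inv (expectationFunctional Q) = Q :=
    Function.leftInverse_invFun injective_expectationFunctional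
  have hconv : ∀ (Q₁ Q₂ : ProbabilityMeasure S) (a b : ℝ), 0 ≤ a → 0 ≤ b → a + b = 1 →
      ∃ (Q : ProbabilityMeasure S), expectationFunctional Q
        = a • expectationFunctional Q₁ + b • expectationFunctional Q₂ ∧
        ∀ s₁ s₂, R Q (a * s₁ + b * s₂) ≤ max (R Q₁ s₁) (R Q₂ s₂) := by
    intro Q₁ Q₂ a b ha hb hab
    lift a to ℝ≥0 using ha
    lift b to ℝ≥0 using hb
    have hab' : a + b = 1 := by exact_mod_cast hab
    obtain ⟨Q, hQ⟩ := exists_probabilityMeasure_eq_smul_add Q₁ Q₂ hab'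
    refine ⟨Q, ?_, fun s₁ s₂ => hR.quasiconvex Q₁ Q₂ Q s₁ s₂ a b hab' hQ⟩
    refine DFunLike.ext _ _ fun X => ?_
    exact integral_of_eq_smul_add hQ X
  have hsion := Sion.minimax' (X := Set.range (expectationFunctional (S := S))) (Y := C)
    (f := fun φ X => R (inv φ) (φ X)) (Set.range_nonempty _)
    (by
      rintro _ ⟨Q₁, rfl⟩ _ ⟨Q₂, rfl⟩ a b ha hb hab
      obtain ⟨Q, hQ, -⟩ := hconv Q₁ Q₂ a b ha hb hab
      exact ⟨Q, hQ⟩)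
    (isCompact_range continuous_expectationFunctional)
    (by
      rintro X hX _ ⟨Q, rfl⟩ c hc
      rw [← hemb.map_nhds_eq, eventually_map]
      simp only [hinv, expectationFunctional_apply] at hc ⊢
      have h := hR.eventually_lt (hcont X hX Q) hc
      have ht : Tendsto (fun Q' : ProbabilityMeasure S => (Q', (0 : ℝ))) (𝓝 Q) (𝓝 (Q, 0)) :=
        (Continuous.prodMk_left (0 : ℝ)).tendsto Q
      simpa using ht.eventually h)
    (by
      rintro X hX r _ ⟨⟨Q₁, rfl⟩, h₁⟩ _ ⟨⟨Q₂, rfl⟩, h₂⟩ a b ha hb hab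
      obtain ⟨Q, hQ, hle⟩ := hconv Q₁ Q₂ a b ha hb hab
      rw [← hQ]
      refine ⟨⟨Q, rfl⟩, ?_⟩
      simp only [hinv] at h₁ h₂ ⊢
      rw [hQ]
      exact (hle _ _).trans (max_le h₁ h₂))
    hC
    (by
      rintro _ ⟨Q, rfl⟩ X hX c hc
      simp only [hinv] at hc ⊢
      obtain ⟨t, ht, htc⟩ := exists_gt_lt_of_rightContinuous (hR.rightContinuous Q _) hc
      have hcts : Continuous fun Z : C(S, ℝ) => expectationFunctional Q Z :=
        (WeakDual.toStrongDual (expectationFunctional Q)).continuous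
      filter_upwards [mem_nhdsWithin_of_mem_nhds (hcts.continuousAt.eventually (gt_mem_nhds ht))]
        with Z hZ
      exact (hR.mono Q (le_of_lt hZ)).trans_lt htc)
    (by
      rintro _ ⟨Q, rfl⟩ r X ⟨hX, h₁⟩ Z ⟨hZ, h₂⟩ a b ha hb hab
      refine ⟨hC hX hZ ha hb hab, ?_⟩
      obtain rfl : a = 1 - b := by linarith
      simp only [hinv] at h₁ h₂ ⊢
      rw [map_add, map_smul, map_smul, smul_eq_mul, smul_eq_mul]
      rcases le_total (expectationFunctional Q X) (expectationFunctional Q Z) with h | h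
      · exact h₁.trans (hR.mono Q (by nlinarith [mul_nonneg hb (sub_nonneg.2 h), mul_nonneg ha (sub_nonneg.2 h)]))
      · exact h₂.trans (hR.mono Q (by nlinarith [mul_nonneg hb (sub_nonneg.2 h), mul_nonneg ha (sub_nonneg.2 h)])))
  simp only [iInf_range, hinv, expectationFunctional_apply] at hsion
  rw [hsion]
  simp_rw [hR.represents]

/-- The minimax identity over a set of continuous functions that is dense in its convex hull. -/
theorem IsDualFunction.iSup_certaintyEquiv_eq_iInf_iSup (hR : IsDualFunction μ₀ v R)
    {K : Set C(S, ℝ)} (hK : convexHull ℝ K ⊆ closure K)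
    (hcont : ∀ X ∈ convexHull ℝ K, ∀ Q, ContinuousAt (R Q) (∫ θ, X θ ∂(Q : Measure S))) :
    ⨆ X ∈ K, certaintyEquiv μ₀ v X
      = ⨅ Q : ProbabilityMeasure S, ⨆ X ∈ K, R Q (∫ θ, X θ ∂(Q : Measure S)) := by
  refine le_antisymm ?_ ?_
  · refine le_iInf fun Q => iSup₂_mono fun X _ => ?_
    rw [hR.represents]
    exact iInf_le _ Q
  · calc ⨅ Q : ProbabilityMeasure S, ⨆ X ∈ K, R Q (∫ θ, X θ ∂(Q : Measure S))
        ≤ ⨅ Q : ProbabilityMeasure S, ⨆ X ∈ convexHull ℝ K, R Q (∫ θ, X θ ∂(Q : Measure S)) :=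
          iInf_mono fun Q => biSup_mono fun X hX => subset_convexHull ℝ K hX
      _ = ⨆ X ∈ convexHull ℝ K, certaintyEquiv μ₀ v X :=
          hR.iInf_iSup_eq_iSup_certaintyEquiv (convex_convexHull ℝ K) hcont
      _ ≤ ⨆ X ∈ K, certaintyEquiv μ₀ v X := by
          refine iSup₂_le fun X hX => le_of_forall_lt_imp_le_of_dense fun c hc => ?_
          obtain ⟨ε, hε, h⟩ := hR.exists_pos_forall_le (hcont X hX) hc
          obtain ⟨Z, hZ, hXZ⟩ := Metric.mem_closure_iff.1 (hK hX) ε hε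
          exact le_iSup₂_of_le Z hZ (h Z (by rwa [← dist_eq_norm]))

end Minimax

/-! ### Non-atomic measures and approximate Lyapunov convexity -/

section NonAtomic

variable {α : Type*} {mα : MeasurableSpace α} {μ : Measure α}

/-- Of a proper piece and its complement, one has at most half the measure; iterate. -/
lemma NonAtomicOn.exists_subset_measure_le [IsFiniteMeasure μ] (h : NonAtomicOn μ mα) {A : Set α}
    (hA : MeasurableSet A) (hpos : 0 < μ A) {ε : ℝ≥0∞} (hε : 0 < ε) :
    ∃ B ⊆ A, MeasurableSet B ∧ 0 < μ B ∧ μ B ≤ ε := by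
  have half : ∀ C : Set α, MeasurableSet C → 0 < μ C →
      ∃ B ⊆ C, MeasurableSet B ∧ 0 < μ B ∧ μ B ≤ μ C / 2 := by
    intro C hC hCpos
    obtain ⟨B, hBC, hB, hBpos, hBlt⟩ := h C hC hCpos
    have hsum : μ B + μ (C \ B) = μ C := measure_add_sdiff hB.nullMeasurableSet C ▸ by
      rw [Set.union_eq_self_of_subset_left hBC]
    rcases le_total (μ B) (μ C / 2) with hle | hle
    · exact ⟨B, hBC, hB, hBpos, hle⟩
    · refine ⟨C \ B, Set.sdiff_subset, hC.diff hB, ?_, ?_⟩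
      · rw [pos_iff_ne_zero]
        intro h0
        rw [h0, add_zero] at hsum
        exact hBlt.ne hsum
      · have h1 : μ C / 2 + μ (C \ B) ≤ μ C / 2 + μ C / 2 := by
          rw [ENNReal.add_halves, ← hsum]
          gcongr
          rw [hsum]; exact hle
        exact (ENNReal.add_le_add_iff_left
          (ENNReal.div_ne_top (measure_ne_top μ C) two_ne_zero)).1 h1
  have iter : ∀ n : ℕ, ∃ B ⊆ A, MeasurableSet B ∧ 0 < μ B ∧ μ B ≤ μ A * (1 / 2) ^ n := by
    intro n
    induction n with
    | zero => exact ⟨A, subset_rfl, hA, hpos, by simp⟩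
    | succ n ih =>
      obtain ⟨B, hBA, hB, hBpos, hBle⟩ := ih
      obtain ⟨D, hDB, hD, hDpos, hDle⟩ := half B hB hBpos
      refine ⟨D, hDB.trans hBA, hD, hDpos, hDle.trans ?_⟩
      rw [pow_succ, ← mul_assoc, ENNReal.div_eq_inv_mul, mul_comm, one_div]
      gcongr
      simpa using hBle
  have hlim : Tendsto (fun n : ℕ => μ A * (1 / 2 : ℝ≥0∞) ^ n) atTop (𝓝 (μ A * 0)) :=
    ENNReal.Tendsto.const_mul (ENNReal.tendsto_pow_atTop_nhds_zero_of_lt_one (by simp))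
      (Or.inr (measure_ne_top μ A))
  rw [mul_zero] at hlim
  obtain ⟨n, hn⟩ := (hlim.eventually (gt_mem_nhds hε)).exists
  obtain ⟨B, hBA, hB, hBpos, hBle⟩ := iter n
  exact ⟨B, hBA, hB, hBpos, hBle.trans hn.le⟩

/-- **Sierpiński's theorem**: a non-atomic finite measure takes all intermediate values. -/
theorem NonAtomicOn.exists_subset_measure_eq [IsFiniteMeasure μ] (h : NonAtomicOn μ mα)
    {A : Set α} (hA : MeasurableSet A) {c : ℝ≥0∞} (hc : c ≤ μ A) :
    ∃ B ⊆ A, MeasurableSet B ∧ μ B = c := by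
  -- Greedy exhaustion: each step adds a candidate whose measure is at least half of the supremum
  -- over all candidates.
  let cand : Set α → Set (Set α) := fun B => {C | MeasurableSet C ∧ C ⊆ A \ B ∧ μ B + μ C ≤ c}
  have hex : ∀ B : Set α, ∃ D : Set α, μ B ≤ c → D ∈ cand B ∧ ∀ C ∈ cand B, μ C ≤ 2 * μ D := by
    intro B
    by_cases hB : μ B ≤ c
    swap
    · exact ⟨∅, fun h => absurd h hB⟩
    set s := ⨆ C : cand B, μ C.1 with hs
    have hle : ∀ C ∈ cand B, μ C ≤ s := fun C hC => le_iSup (fun C : cand B => μ C.1) ⟨C, hC⟩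
    rcases eq_or_ne s 0 with h0 | h0
    · refine ⟨∅, fun _ => ⟨⟨MeasurableSet.empty, Set.empty_subset _, by simpa using hB⟩, ?_⟩⟩
      intro C hC
      have := hle C hC
      rw [h0] at this
      exact this.trans zero_le
    · have hst : s ≠ ⊤ := ne_top_of_le_ne_top (measure_ne_top μ Set.univ)
        (iSup_le fun C => measure_mono (Set.subset_univ _))
      obtain ⟨⟨D, hD⟩, hlt⟩ := lt_iSup_iff.1 (hs ▸ ENNReal.half_lt_self h0 hst)
      refine ⟨D, fun _ => ⟨hD, fun C hC => (hle C hC).trans ?_⟩⟩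
      calc s = 2 * (s / 2) := (ENNReal.mul_div_cancel two_ne_zero ENNReal.ofNat_ne_top).symm
        _ ≤ 2 * μ D := by gcongr
  choose f hf using hex
  let B : ℕ → Set α := fun n => Nat.rec ∅ (fun _ B => B ∪ f B) n
  have hBsucc : ∀ n, B (n + 1) = B n ∪ f (B n) := fun n => rfl
  have hB : ∀ n, MeasurableSet (B n) ∧ B n ⊆ A ∧ μ (B n) ≤ c := by
    intro n
    induction n with
    | zero => exact ⟨MeasurableSet.empty, Set.empty_subset _, by simp [B]⟩
    | succ n ih =>
      obtain ⟨⟨hm, hsub, hle⟩, -⟩ := hf _ ih.2.2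
      rw [hBsucc]
      exact ⟨ih.1.union hm, Set.union_subset ih.2.1 (hsub.trans Set.sdiff_subset),
        (measure_union_le _ _).trans hle⟩
  have hmono : Monotone B := monotone_nat_of_le_succ fun n => by
    rw [hBsucc]; exact Set.subset_union_left
  have hstep : ∀ n, μ (B (n + 1)) = μ (B n) + μ (f (B n)) := by
    intro n
    obtain ⟨⟨hm, hsub, -⟩, -⟩ := hf _ (hB n).2.2
    rw [hBsucc, measure_union (Set.disjoint_sdiff_right.mono_right hsub) hm]
  have hU : μ (⋃ n, B n) ≤ c := by
    rw [hmono.measure_iUnion]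
    exact iSup_le fun n => (hB n).2.2
  have hUm : MeasurableSet (⋃ n, B n) := MeasurableSet.iUnion fun n => (hB n).1
  have hUA : (⋃ n, B n) ⊆ A := Set.iUnion_subset fun n => (hB n).2.1
  refine ⟨⋃ n, B n, hUA, hUm, ?_⟩
  by_contra hne
  have hlt : μ (⋃ n, B n) < c := lt_of_le_of_ne hU hne
  have hrest : 0 < μ (A \ ⋃ n, B n) := by
    rw [measure_sdiff hUA hUm.nullMeasurableSet (measure_ne_top μ _)]
    exact tsub_pos_of_lt (hlt.trans_le hc)
  obtain ⟨C, hCsub, hC, hCpos, hCle⟩ :=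
    h.exists_subset_measure_le (hA.diff hUm) hrest (tsub_pos_of_lt hlt)
  have hcand : ∀ n, C ∈ cand (B n) := fun n => by
    refine ⟨hC, hCsub.trans (Set.sdiff_subset_sdiff_right (Set.subset_iUnion B n)), ?_⟩
    calc μ (B n) + μ C ≤ μ (⋃ n, B n) + (c - μ (⋃ n, B n)) := by
          gcongr
          exact Set.subset_iUnion B n
      _ = c := add_tsub_cancel_of_le hU
  -- If the union falls short of `c`, the set `C` stays a candidate forever, so every step adds at
  -- least μ(C)/2, which a finite measure cannot accommodate.
  have hgrow : ∀ n : ℕ, n * μ C ≤ 2 * μ (B n) := by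
    intro n
    induction n with
    | zero => simp
    | succ n ih =>
      rw [hstep, mul_add, Nat.cast_succ, add_mul, one_mul]
      exact add_le_add ih ((hf _ (hB n).2.2).2 C (hcand n))
  obtain ⟨n, hn⟩ := ENNReal.exists_nat_mul_gt hCpos.ne'
    (ENNReal.mul_ne_top ENNReal.ofNat_ne_top (measure_ne_top μ A) : 2 * μ A ≠ ⊤)
  refine hn.not_ge ((hgrow n).trans ?_)
  gcongr
  exact (hB n).2.1

variable {E : Type*} [NormedAddCommGroup E] [NormedSpace ℝ E] [CompleteSpace E]

/-- Take the proportion `c` of each level set, by Sierpiński's theorem. -/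
lemma NonAtomicOn.exists_setIntegral_simpleFunc_eq [IsFiniteMeasure μ] (h : NonAtomicOn μ mα)
    (φ : SimpleFunc α E) (hφ : Integrable φ μ) {c : ℝ} (hc0 : 0 ≤ c) (hc1 : c ≤ 1) :
    ∃ A, MeasurableSet A ∧ ∫ x in A, φ x ∂μ = c • ∫ x, φ x ∂μ := by
  have hex : ∀ y : E, ∃ B ⊆ φ ⁻¹' {y}, MeasurableSet B ∧
      μ B = ENNReal.ofReal c * μ (φ ⁻¹' {y}) := fun y =>
    h.exists_subset_measure_eq (φ.measurableSet_fiber y)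
      (mul_le_of_le_one_left zero_le (ENNReal.ofReal_le_one.2 hc1))
  choose B hBsub hBm hBμ using hex
  refine ⟨⋃ y ∈ φ.range, B y, φ.range.measurableSet_biUnion fun y _ => hBm y, ?_⟩
  have hinter : ∀ y ∈ φ.range, φ ⁻¹' {y} ∩ ⋃ z ∈ φ.range, B z = B y := by
    intro y hy
    ext x
    simp only [Set.mem_inter_iff, Set.mem_preimage, Set.mem_singleton_iff, Set.mem_iUnion,
      exists_prop]
    constructor
    · rintro ⟨rfl, z, -, hz⟩
      have : φ x = z := hBsub z hz
      rwa [this]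
    · intro hx
      exact ⟨hBsub y hx, y, hy, hx⟩
  rw [SimpleFunc.integral_eq_sum φ hφ, SimpleFunc.integral_eq_sum φ hφ.restrict, Finset.smul_sum]
  refine Finset.sum_congr rfl fun y hy => ?_
  rw [measureReal_restrict_apply (φ.measurableSet_fiber y), hinter y hy, smul_smul]
  congr 1
  rw [measureReal_def, hBμ, ENNReal.toReal_mul, ENNReal.toReal_ofReal hc0, measureReal_def]

/-- Approximate convexity of the range of a vector measure with integrable density with respect to
a non-atomic measure. -/
lemma NonAtomicOn.exists_norm_setIntegral_sub_le_self [IsFiniteMeasure μ] (h : NonAtomicOn μ mα)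
    {g : α → E} (hg : Integrable g μ) {c : ℝ} (hc0 : 0 ≤ c) (hc1 : c ≤ 1) {ε : ℝ} (hε : 0 < ε) :
    ∃ A, MeasurableSet A ∧ ‖∫ x in A, g x ∂μ - c • ∫ x, g x ∂μ‖ ≤ ε := by
  obtain ⟨φ, hφ, hφi⟩ := (memLp_one_iff_integrable.2 hg).exists_simpleFunc_eLpNorm_sub_lt
    ENNReal.one_ne_top (ε := ENNReal.ofReal (ε / 2)) (by simpa using hε)
  rw [memLp_one_iff_integrable] at hφi
  obtain ⟨A, hA, hAφ⟩ := h.exists_setIntegral_simpleFunc_eq φ hφi hc0 hc1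
  refine ⟨A, hA, ?_⟩
  have hd : Integrable (g - ⇑φ) μ := hg.sub hφi
  have hsmall : ∫ x, ‖(g - ⇑φ) x‖ ∂μ ≤ ε / 2 := by
    rw [integral_norm_eq_lintegral_enorm hd.aestronglyMeasurable, ← eLpNorm_one_eq_lintegral_enorm]
    exact ENNReal.toReal_le_of_le_ofReal (by positivity) hφ.le
  have e : ∫ x in A, g x ∂μ - c • ∫ x, g x ∂μ
      = ∫ x in A, (g - ⇑φ) x ∂μ - c • ∫ x, (g - ⇑φ) x ∂μ := by
    simp only [Pi.sub_apply]
    rw [integral_sub hg.restrict hφi.restrict, integral_sub hg hφi, smul_sub, hAφ]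
    abel
  rw [e]
  have h1 : ‖∫ x in A, (g - ⇑φ) x ∂μ‖ ≤ ε / 2 :=
    (norm_integral_le_integral_norm _).trans
      ((setIntegral_le_integral hd.norm (Eventually.of_forall fun x => norm_nonneg _)).trans hsmall)
  have h2 : ‖c • ∫ x, (g - ⇑φ) x ∂μ‖ ≤ ε / 2 := by
    rw [norm_smul, Real.norm_of_nonneg hc0]
    calc c * ‖∫ x, (g - ⇑φ) x ∂μ‖ ≤ 1 * (ε / 2) := by
          gcongr
          exact (norm_integral_le_integral_norm _).trans hsmall
      _ = ε / 2 := one_mul _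
  linarith [norm_sub_le (∫ x in A, (g - ⇑φ) x ∂μ) (c • ∫ x, (g - ⇑φ) x ∂μ)]

end NonAtomic

/-- On events of `m`, `f` and its conditional expectation have the same integrals, so the previous
lemma is applied to the latter under the trimmed measure. -/
lemma NonAtomicOn.exists_norm_setIntegral_sub_le {α : Type*} {m mα : MeasurableSpace α}
    (hm : m ≤ mα) {μ : Measure α} [IsFiniteMeasure μ] (h : NonAtomicOn μ m)
    {E : Type*} [NormedAddCommGroup E] [NormedSpace ℝ E] [CompleteSpace E]
    {f : α → E} (hf : Integrable f μ) {c : ℝ} (hc0 : 0 ≤ c) (hc1 : c ≤ 1) {ε : ℝ} (hε : 0 < ε) :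
    ∃ A, MeasurableSet[m] A ∧ ‖∫ x in A, f x ∂μ - c • ∫ x, f x ∂μ‖ ≤ ε := by
  have htrim : @NonAtomicOn α m (μ.trim hm) m := by
    intro A hA hpos
    rw [trim_measurableSet_eq hm hA] at hpos
    obtain ⟨B, hBA, hB, hBpos, hBlt⟩ := h A hA hpos
    refine ⟨B, hBA, hB, ?_, ?_⟩
    · rwa [trim_measurableSet_eq hm hB]
    · rwa [trim_measurableSet_eq hm hB, trim_measurableSet_eq hm hA]
  obtain ⟨A, hA, hle⟩ := htrim.exists_norm_setIntegral_sub_le_self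
    ((integrable_condExp (f := f)).trim hm stronglyMeasurable_condExp)
    hc0 hc1 hε
  refine ⟨A, hA, ?_⟩
  rwa [← setIntegral_trim hm stronglyMeasurable_condExp hA,
    ← integral_trim hm stronglyMeasurable_condExp, setIntegral_condExp hm hf hA,
    integral_condExp hm] at hle

/-! ### Delaying and switching stopping times -/

section StopTimes

variable {Ω : Type*} [mΩ : MeasurableSpace Ω] {T : ℝ} {𝓕 : Filtration (Time T) mΩ}

lemma StopTime.measurableSet_le (τ : StopTime 𝓕) (t : Time T) :
    MeasurableSet[𝓕 t] {ω | τ.1 ω ≤ t} := by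
  have h := τ.2 t
  simpa only [WithTop.coe_le_coe] using h

lemma StopTime.measurable (τ : StopTime 𝓕) : Measurable τ.1 :=
  measurable_of_Iic fun t => 𝓕.le t _ (τ.measurableSet_le t)

open Classical in
/-- The stopping time that follows `τ₁` on the event `A` of `𝓕 δ` and `τ₂` off `A`, but never stops
before `δ`. -/
noncomputable def StopTime.switch (τ₁ τ₂ : StopTime 𝓕) (δ : Time T) (A : Set Ω)
    (hA : MeasurableSet[𝓕 δ] A) : StopTime 𝓕 :=
  ⟨fun ω => if ω ∈ A then max (τ₁.1 ω) δ else max (τ₂.1 ω) δ, by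
    intro t
    simp only [WithTop.coe_le_coe]
    by_cases hδ : δ ≤ t
    · have hAt : MeasurableSet[𝓕 t] A := 𝓕.mono hδ A hA
      convert ((hAt.inter (τ₁.measurableSet_le t)).union
        (hAt.compl.inter (τ₂.measurableSet_le t))) using 1
      ext ω
      by_cases hω : ω ∈ A <;> simp [hω, hδ]
    -- Before `δ` nothing has stopped, so `A` need not be known yet.
    · convert MeasurableSet.empty using 1
      ext ω
      by_cases hω : ω ∈ A <;> simp [hω, hδ]⟩

/-- The stopping time `τ ∨ δ`. -/
noncomputable def StopTime.delay (τ : StopTime 𝓕) (δ : Time T) : StopTime 𝓕 :=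
  τ.switch τ δ Set.univ MeasurableSet.univ

lemma StopTime.delay_apply (τ : StopTime 𝓕) (δ : Time T) (ω : Ω) :
    (τ.delay δ).1 ω = max (τ.1 ω) δ := by
  simp [delay, switch]

lemma payoff_switch (Y : Time T → Ω → ℝ) (τ₁ τ₂ : StopTime 𝓕) (δ : Time T) {A : Set Ω}
    (hA : MeasurableSet[𝓕 δ] A) :
    payoff Y (τ₁.switch τ₂ δ A hA)
      = A.indicator (payoff Y (τ₁.delay δ)) + Aᶜ.indicator (payoff Y (τ₂.delay δ)) := by
  ext ω
  by_cases hω : ω ∈ A <;> simp [payoff, StopTime.delay_apply, StopTime.switch, hω]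

lemma enorm_payoff_le (Y : Time T → Ω → ℝ) (τ : StopTime 𝓕) (ω : Ω) :
    ‖payoff Y τ ω‖ₑ ≤ supAbs Y ω :=
  le_iSup (fun t => ‖Y t ω‖ₑ) (τ.1 ω)

lemma enorm_indicator_payoff_le (Y : Time T → Ω → ℝ) (τ : StopTime 𝓕) (A : Set Ω) (ω : Ω) :
    ‖A.indicator (payoff Y τ) ω‖ₑ ≤ supAbs Y ω :=
  (enorm_indicator_le_enorm_self _ _).trans (enorm_payoff_le Y τ ω)

lemma measurable_eval_of_countable {Ω I : Type*} [MeasurableSpace Ω] {Y : I → Ω → ℝ}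
    (hY : ∀ t, Measurable (Y t)) {k : Ω → ℕ} (hk : Measurable k) (e : ℕ → I) :
    Measurable fun ω => Y (e (k ω)) ω := by
  have h : Measurable fun p : ℕ × Ω => Y (e p.1) p.2 :=
    measurable_from_prod_countable_right fun j => hY (e j)
  exact h.comp (hk.prodMk measurable_id)

/-- The pay-off of an adapted right-continuous process at a stopping time is measurable. -/
lemma measurable_payoff {Y : Time T → Ω → ℝ} (hY : Adapted 𝓕 Y)
    (hYright : ∀ ω t, ContinuousWithinAt (fun s => Y s ω) (Set.Ici t) t) (τ : StopTime 𝓕) :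
    Measurable (payoff Y τ) := by
  by_cases hT : 0 ≤ T
  swap
  · have : IsEmpty Ω := ⟨fun ω => hT ((τ.1 ω).2.1.trans (τ.1 ω).2.2)⟩
    exact measurable_of_empty _
  have hYm : ∀ t, Measurable (Y t) := fun t => (hY t).mono (𝓕.le t) le_rfl
  -- Grid approximation of `τ` with mesh 1/(n+1). The `+ 1` in the numerator of `e` keeps it to the
  -- right of `τ`, where `Y` is continuous; `projIcc` truncates at `T`.
  let k : ℕ → Ω → ℕ := fun n ω => ⌊((n : ℝ) + 1) * (τ.1 ω : ℝ)⌋₊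
  let e : ℕ → ℕ → ℝ := fun n j => ((j : ℝ) + 1) / ((n : ℝ) + 1)
  have hk : ∀ n, Measurable (k n) := fun n =>
    Nat.measurable_floor.comp ((measurable_subtype_coe.comp τ.measurable).const_mul _)
  have hlb : ∀ n ω, (τ.1 ω : ℝ) ≤ e n (k n ω) := by
    intro n ω
    have hn : (0 : ℝ) < (n : ℝ) + 1 := by positivity
    rw [le_div_iff₀ hn, mul_comm]
    exact (Nat.lt_floor_add_one _).le
  have hub : ∀ n ω, e n (k n ω) ≤ (τ.1 ω : ℝ) + 1 / ((n : ℝ) + 1) := by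
    intro n ω
    have hn : (0 : ℝ) < (n : ℝ) + 1 := by positivity
    have h1 : (k n ω : ℝ) ≤ ((n : ℝ) + 1) * (τ.1 ω : ℝ) :=
      Nat.floor_le (mul_nonneg hn.le (τ.1 ω).2.1)
    rw [div_le_iff₀ hn, add_mul, one_div, inv_mul_cancel₀ hn.ne']
    linarith
  refine measurable_of_tendsto_metrizable
    (f := fun n ω => Y (Set.projIcc 0 T hT (e n (k n ω))) ω) (fun n => ?_) ?_
  · exact measurable_eval_of_countable hYm (hk n) fun j => Set.projIcc 0 T hT (e n j)
  · rw [tendsto_pi_nhds]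
    intro ω
    have hproj : Set.projIcc 0 T hT (τ.1 ω : ℝ) = τ.1 ω := Set.projIcc_val hT _
    have hlim : Tendsto (fun n => e n (k n ω)) atTop (𝓝 (τ.1 ω : ℝ)) := by
      refine tendsto_of_tendsto_of_tendsto_of_le_of_le tendsto_const_nhds ?_
        (fun n => hlb n ω) (fun n => hub n ω)
      simpa using (tendsto_const_nhds (x := (τ.1 ω : ℝ))).add
        (tendsto_one_div_add_atTop_nhds_zero_nat (𝕜 := ℝ))
    have hlim' : Tendsto (fun n => Set.projIcc 0 T hT (e n (k n ω))) atTop (𝓝 (τ.1 ω)) := by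
      have := (continuous_projIcc (h := hT)).continuousAt.tendsto.comp hlim
      rwa [hproj] at this
    refine (hYright ω (τ.1 ω)).tendsto.comp (tendsto_nhdsWithin_iff.2 ⟨hlim', ?_⟩)
    refine Eventually.of_forall fun n => ?_
    have := Set.monotone_projIcc hT (hlb n ω)
    rwa [hproj] at this

end StopTimes

/-! ### Scenario expectations and their approximate convexity -/

section Scenarios

variable {S Ω : Type*} [MeasurableSpace S] [mΩ : MeasurableSpace Ω] {T : ℝ}
  {𝓕 : Filtration (Time T) mΩ} {P : Measure Ω} {κ : Kernel S Ω} {Y : Time T → Ω → ℝ}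

/-- Only `W` has to be measurable: monotonicity of the lower integral asks nothing of the
uncountable supremum `supAbs`. -/
lemma UniformlyIntegrablePayoff.integrable (h : UniformlyIntegrablePayoff κ Y) {W : Ω → ℝ}
    (hW : Measurable W) (hle : ∀ ω, ‖W ω‖ₑ ≤ supAbs Y ω) (θ : S) : Integrable W (κ θ) := by
  obtain ⟨C, hC⟩ := h
  exact ⟨hW.aestronglyMeasurable,
    (lintegral_mono hle).trans_lt ((hC θ).trans ENNReal.coe_lt_top)⟩

lemma UniformlyIntegrablePayoff.exists_bound (h : UniformlyIntegrablePayoff κ Y) :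
    ∃ C : ℝ, ∀ (τ : StopTime 𝓕) (θ : S), |scenarioValue κ Y τ θ| ≤ C := by
  obtain ⟨C, hC⟩ := h
  refine ⟨C, fun τ θ => ?_⟩
  have h1 : ‖scenarioValue κ Y τ θ‖ₑ ≤ C :=
    (enorm_integral_le_lintegral_enorm _).trans
      ((lintegral_mono (enorm_payoff_le Y τ)).trans (hC θ).le)
  rw [← ofReal_norm] at h1
  have h2 := ENNReal.toReal_mono ENNReal.coe_ne_top h1
  rwa [ENNReal.toReal_ofReal (norm_nonneg _)] at h2

/-- Delaying a stopping time by a short time changes the scenario expectations little, uniformly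
over the scenarios. -/
lemma tendsto_scenarioValue_delay (hY : Adapted 𝓕 Y)
    (hYright : ∀ ω t, ContinuousWithinAt (fun s => Y s ω) (Set.Ici t) t)
    (h_int : UniformlyIntegrablePayoff κ Y) (h_stop : ContinuousAlongStopTimes P 𝓕 κ Y)
    (τ : StopTime 𝓕) {δ : ℕ → Time T} (hδ : Tendsto (fun n => (δ n : ℝ)) atTop (𝓝 0))
    {ε : ℝ} (hε : 0 < ε) :
    ∀ᶠ n in atTop, ∀ θ, |scenarioValue κ Y (τ.delay (δ n)) θ - scenarioValue κ Y τ θ| < ε := by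
  have hlim : ∀ ω, Tendsto (fun n => (τ.delay (δ n)).1 ω) atTop (𝓝 (τ.1 ω)) := by
    intro ω
    rw [tendsto_subtype_rng]
    have h1 : Tendsto (fun n => max (τ.1 ω : ℝ) (δ n)) atTop (𝓝 (max (τ.1 ω : ℝ) 0)) :=
      tendsto_const_nhds.max hδ
    rw [max_eq_left (τ.1 ω).2.1] at h1
    refine h1.congr fun n => ?_
    rw [StopTime.delay_apply]
    exact ((Subtype.mono_coe _).map_max).symm
  have h := Metric.tendstoUniformly_iff.1
    (h_stop (fun n => τ.delay (δ n)) τ (Eventually.of_forall hlim)) ε hε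
  filter_upwards [h] with n hn θ
  have := hn θ
  rw [integral_sub (h_int.integrable (measurable_payoff hY hYright _) (enorm_payoff_le Y _) θ)
    (h_int.integrable (measurable_payoff hY hYright _) (enorm_payoff_le Y _) θ), dist_comm,
    Real.dist_eq, sub_zero] at this
  exact this

variable [IsMarkovKernel κ]

lemma mixedValue_eq_integral (hY : Adapted 𝓕 Y)
    (hYright : ∀ ω t, ContinuousWithinAt (fun s => Y s ω) (Set.Ici t) t)
    (h_int : UniformlyIntegrablePayoff κ Y) (τ : StopTime 𝓕) (Q : ProbabilityMeasure S) :
    mixedValue κ Y τ Q = ∫ θ, scenarioValue κ Y τ θ ∂(Q : Measure S) := by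
  have hm : Measurable fun p : S × Ω => payoff Y τ p.2 :=
    (measurable_payoff hY hYright τ).comp measurable_snd
  have hint : Integrable (fun p : S × Ω => payoff Y τ p.2) ((Q : Measure S) ⊗ₘ κ) := by
    refine ⟨hm.aestronglyMeasurable, ?_⟩
    obtain ⟨C, hC⟩ := h_int
    rw [HasFiniteIntegral, Measure.lintegral_compProd hm.enorm]
    calc ∫⁻ θ, ∫⁻ ω, ‖payoff Y τ ω‖ₑ ∂(κ θ) ∂(Q : Measure S)
        ≤ ∫⁻ _, C ∂(Q : Measure S) :=
          lintegral_mono fun θ => (lintegral_mono (enorm_payoff_le Y τ)).trans (hC θ).le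
      _ < ⊤ := by simp
  exact Measure.integral_compProd hint

variable [IsProbabilityMeasure P]

lemma ofReal_abs_integral_sub_le (h_ac : ∀ θ, κ θ ≪ P) (h_int : UniformlyIntegrablePayoff κ Y)
    {W : Ω → ℝ} (hW : Measurable W) (hle : ∀ ω, ‖W ω‖ₑ ≤ supAbs Y ω) (θ₁ θ₂ : S) :
    ENNReal.ofReal |∫ ω, W ω ∂(κ θ₁) - ∫ ω, W ω ∂(κ θ₂)| ≤
      ∫⁻ ω, ENNReal.ofReal
          |((κ θ₁).rnDeriv P ω).toReal - ((κ θ₂).rnDeriv P ω).toReal| * supAbs Y ω ∂P := by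
  rw [← integral_rnDeriv_smul (h_ac θ₁), ← integral_rnDeriv_smul (h_ac θ₂), ← integral_sub
    ((integrable_rnDeriv_smul_iff (h_ac θ₁)).2 (h_int.integrable hW hle θ₁))
    ((integrable_rnDeriv_smul_iff (h_ac θ₂)).2 (h_int.integrable hW hle θ₂)),
    ← Real.norm_eq_abs, ofReal_norm]
  refine (enorm_integral_le_lintegral_enorm _).trans (lintegral_mono fun ω => ?_)
  rw [← sub_smul, enorm_smul, ← Real.norm_eq_abs, ofReal_norm]
  gcongr
  exact hle ω

variable [MetricSpace S]

/-- Expectations of random variables dominated by the running supremum depend on the scenario in a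
uniformly continuous way, with a common modulus of continuity. -/
lemma ContinuousInScenario.exists_modulus (h_scen : ContinuousInScenario P κ Y)
    (h_ac : ∀ θ, κ θ ≪ P) (h_int : UniformlyIntegrablePayoff κ Y) {ε : ℝ} (hε : 0 < ε) :
    ∃ h > 0, ∀ θ₁ θ₂ : S, dist θ₁ θ₂ ≤ h → ∀ W : Ω → ℝ, Measurable W →
      (∀ ω, ‖W ω‖ₑ ≤ supAbs Y ω) → |∫ ω, W ω ∂(κ θ₁) - ∫ ω, W ω ∂(κ θ₂)| ≤ ε := by
  have hev := h_scen.eventually (gt_mem_nhds (ENNReal.ofReal_pos.2 hε))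
  obtain ⟨h, hlt, hpos⟩ := (hev.and self_mem_nhdsWithin).exists
  refine ⟨h, hpos, fun θ₁ θ₂ hd W hW hle => ?_⟩
  have h1 := (ofReal_abs_integral_sub_le h_ac h_int hW hle θ₁ θ₂).trans
    ((le_iSup_of_le θ₁ (le_iSup_of_le θ₂ (le_iSup
      (fun _ : dist θ₁ θ₂ ≤ h => ∫⁻ ω, ENNReal.ofReal
        |((κ θ₁).rnDeriv P ω).toReal - ((κ θ₂).rnDeriv P ω).toReal| * supAbs Y ω ∂P) hd))).trans
      hlt.le)
  exact (ENNReal.ofReal_le_ofReal_iff hε.le).1 h1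

lemma continuous_scenarioValue (hY : Adapted 𝓕 Y)
    (hYright : ∀ ω t, ContinuousWithinAt (fun s => Y s ω) (Set.Ici t) t)
    (h_scen : ContinuousInScenario P κ Y) (h_ac : ∀ θ, κ θ ≪ P)
    (h_int : UniformlyIntegrablePayoff κ Y) (τ : StopTime 𝓕) :
    Continuous (scenarioValue κ Y τ) := by
  refine Metric.continuous_iff.2 fun θ ε hε => ?_
  obtain ⟨h, hpos, hmod⟩ := h_scen.exists_modulus h_ac h_int (half_pos hε)
  refine ⟨h, hpos, fun θ' hd => ?_⟩
  have := hmod θ' θ hd.le _ (measurable_payoff hY hYright τ) (enorm_payoff_le Y τ)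
  rw [Real.dist_eq]
  exact this.trans_lt (half_lt_self hε)

/-- A convex combination of the scenario expectations of two stopping times is approximated,
uniformly over the scenarios, by the scenario expectations of a stopping time that switches between
small delays of the two. -/
lemma exists_scenarioValue_approx_combination [CompactSpace S] (hT : 0 < T)
    (hnonatomic : ∀ t : Time T, 0 < (t : ℝ) → NonAtomicOn P (𝓕 t)) (hY : Adapted 𝓕 Y)
    (hYright : ∀ ω t, ContinuousWithinAt (fun s => Y s ω) (Set.Ici t) t)
    (h_ac : ∀ θ, κ θ ≪ P) (h_int : UniformlyIntegrablePayoff κ Y)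
    (h_stop : ContinuousAlongStopTimes P 𝓕 κ Y) (h_scen : ContinuousInScenario P κ Y)
    (τ₁ τ₂ : StopTime 𝓕) {c : ℝ} (hc0 : 0 ≤ c) (hc1 : c ≤ 1) {ε : ℝ} (hε : 0 < ε) :
    ∃ τ : StopTime 𝓕, ∀ θ, |scenarioValue κ Y τ θ
      - (c * scenarioValue κ Y τ₁ θ + (1 - c) * scenarioValue κ Y τ₂ θ)| ≤ 6 * ε := by
  -- The delays are strictly positive because non-atomicity is assumed only at positive times.
  let δs : ℕ → Time T := fun n => ⟨T / ((n : ℝ) + 1), by positivity,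
    div_le_self hT.le (by linarith [n.cast_nonneg (α := ℝ)])⟩
  have hδs : Tendsto (fun n => (δs n : ℝ)) atTop (𝓝 0) := by
    have := (tendsto_one_div_add_atTop_nhds_zero_nat (𝕜 := ℝ)).const_mul T
    simpa [δs, div_eq_mul_inv] using this
  obtain ⟨n, hn₁, hn₂⟩ := ((tendsto_scenarioValue_delay hY hYright h_int h_stop τ₁ hδs hε).and
    (tendsto_scenarioValue_delay hY hYright h_int h_stop τ₂ hδs hε)).exists
  set δ := δs n
  have hδpos : 0 < (δ : ℝ) := by positivity
  set Z₁ := payoff Y (τ₁.delay δ)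
  set Z₂ := payoff Y (τ₂.delay δ)
  have mZ₁ : Measurable Z₁ := measurable_payoff hY hYright _
  have mZ₂ : Measurable Z₂ := measurable_payoff hY hYright _
  have iZ₁ : ∀ θ, Integrable Z₁ (κ θ) := h_int.integrable mZ₁ (enorm_payoff_le Y _)
  have iZ₂ : ∀ θ, Integrable Z₂ (κ θ) := h_int.integrable mZ₂ (enorm_payoff_le Y _)
  obtain ⟨h, hpos, hmod⟩ := h_scen.exists_modulus h_ac h_int hε
  -- A finite `h`-net of scenarios turns the problem into one about a single density with values in
  -- a finite-dimensional space.
  obtain ⟨N, -, hNfin, hN⟩ := finite_cover_balls_of_compact (isCompact_univ (X := S)) hpos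
  have : Fintype N := hNfin.fintype
  let f : Ω → N → ℝ := fun ω i => ((κ i.1).rnDeriv P ω).toReal • (Z₁ ω - Z₂ ω)
  have hfi : ∀ i, Integrable (fun ω => f ω i) P := fun i =>
    (integrable_rnDeriv_smul_iff (h_ac i.1)).2 ((iZ₁ i.1).sub (iZ₂ i.1))
  have hf : Integrable f P := Integrable.of_eval hfi
  obtain ⟨A, hA, hAle⟩ :=
    (hnonatomic δ hδpos).exists_norm_setIntegral_sub_le (𝓕.le δ) hf hc0 hc1 hε
  have mA : MeasurableSet A := 𝓕.le δ _ hA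
  -- `Φ` is the error made by switching on `A` instead of mixing the delayed values with weights c
  -- and 1 - c.
  let Φ : S → ℝ := fun θ => ∫ ω in A, Z₁ ω ∂(κ θ) - ∫ ω in A, Z₂ ω ∂(κ θ)
    - c * (∫ ω, Z₁ ω ∂(κ θ) - ∫ ω, Z₂ ω ∂(κ θ))
  have hΦN : ∀ i ∈ N, |Φ i| ≤ ε := by
    intro i hi
    have h1 := (norm_le_pi_norm _ (⟨i, hi⟩ : N)).trans hAle
    rw [Pi.sub_apply, Pi.smul_apply, eval_integral (fun j => (hfi j).restrict),
      eval_integral hfi] at h1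
    simp only [f] at h1
    rw [setIntegral_rnDeriv_smul (h_ac i) mA, integral_rnDeriv_smul (h_ac i),
      integral_sub (iZ₁ i).restrict (iZ₂ i).restrict, integral_sub (iZ₁ i) (iZ₂ i)] at h1
    exact h1
  -- Passing from the net to `θ` costs ε for each integral over `A` and cε for each full one; with ε
  -- on the net this is at most 5ε. The delays add cε + (1 - c)ε, whence 6ε.
  have hΦ : ∀ θ, |Φ θ| ≤ 5 * ε := by
    intro θ
    obtain ⟨i, hi, hθi⟩ := Set.mem_iUnion₂.1 (hN (Set.mem_univ θ))
    have hd : dist θ i ≤ h := (Metric.mem_ball.1 hθi).le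
    have a1 := hmod θ i hd _ (mZ₁.indicator mA) (enorm_indicator_payoff_le Y _ A)
    have a2 := hmod θ i hd _ (mZ₂.indicator mA) (enorm_indicator_payoff_le Y _ A)
    have a3 := hmod θ i hd _ mZ₁ (enorm_payoff_le Y _)
    have a4 := hmod θ i hd _ mZ₂ (enorm_payoff_le Y _)
    rw [integral_indicator mA, integral_indicator mA] at a1 a2
    have a5 := hΦN i hi
    simp only [Φ, abs_le] at *
    constructor <;> nlinarith
  refine ⟨τ₁.switch τ₂ δ A hA, fun θ => ?_⟩
  have hval : scenarioValue κ Y (τ₁.switch τ₂ δ A hA) θ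
      - (c * scenarioValue κ Y (τ₁.delay δ) θ + (1 - c) * scenarioValue κ Y (τ₂.delay δ) θ)
      = Φ θ := by
    have e1 : scenarioValue κ Y (τ₁.switch τ₂ δ A hA) θ
        = ∫ ω in A, Z₁ ω ∂(κ θ) + ∫ ω in Aᶜ, Z₂ ω ∂(κ θ) := by
      rw [scenarioValue, payoff_switch, integral_add' ((iZ₁ θ).indicator mA)
        ((iZ₂ θ).indicator mA.compl), integral_indicator mA, integral_indicator mA.compl]
    have e2 := integral_add_compl mA (iZ₂ θ)
    rw [e1]
    change _ - (c * ∫ ω, Z₁ ω ∂(κ θ) + (1 - c) * ∫ ω, Z₂ ω ∂(κ θ)) = _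
    simp only [Φ]
    linarith
  have b := hΦ θ
  rw [← hval] at b
  have b1 := hn₁ θ
  have b2 := hn₂ θ
  rw [abs_lt] at b1 b2
  rw [abs_le] at b ⊢
  constructor <;> nlinarith

end Scenarios

/-! ### Assembly of the main theorem -/

section Assembly

lemma convexHull_subset_closure {E : Type*} [AddCommGroup E] [Module ℝ E] [TopologicalSpace E]
    [IsTopologicalAddGroup E] [ContinuousSMul ℝ E] {K : Set E}
    (h : ∀ x ∈ K, ∀ y ∈ K, ∀ a b : ℝ, 0 ≤ a → 0 ≤ b → a + b = 1 → a • x + b • y ∈ closure K) :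
    convexHull ℝ K ⊆ closure K := by
  refine convexHull_min subset_closure fun x hx y hy a b ha hb hab => ?_
  have := map_mem_closure₂ (f := fun x y : E => a • x + b • y) (by fun_prop) hx hy
    fun x hx y hy => h x hx y hy a b ha hb hab
  rwa [closure_closure] at this

lemma nonempty_stopTime {Ω : Type*} [mΩ : MeasurableSpace Ω] {T : ℝ} (hT : 0 ≤ T)
    (𝓕 : Filtration (Time T) mΩ) : Nonempty (StopTime 𝓕) :=
  ⟨⟨fun _ => ⟨0, le_rfl, hT⟩, isStoppingTime_const 𝓕 _⟩⟩

lemma integral_pos_of_forall_pos {S : Type*} [TopologicalSpace S] [CompactSpace S]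
    [MeasurableSpace S] [BorelSpace S] (Q : ProbabilityMeasure S) {X : C(S, ℝ)} (hX : ∀ θ, 0 < X θ) :
    0 < ∫ θ, X θ ∂(Q : Measure S) := by
  rw [integral_pos_iff_support_of_nonneg (fun θ => (hX θ).le) (integrable_continuousMap _ X)]
  have : Function.support X = Set.univ := Set.eq_univ_of_forall fun θ => (hX θ).ne'
  simp [this]

lemma forall_pos_of_mem_convexHull {S : Type*} [TopologicalSpace S] {K : Set C(S, ℝ)}
    (hK : ∀ X ∈ K, ∀ θ, 0 < X θ) {X : C(S, ℝ)} (hX : X ∈ convexHull ℝ K) (θ : S) : 0 < X θ := by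
  have hconv : Convex ℝ {X : C(S, ℝ) | 0 < X θ} := by
    intro X hX Z hZ a b ha hb hab
    exact (convex_Ioi (0 : ℝ)) hX hZ ha hb hab
  exact convexHull_min (fun X hX => hK X hX θ) hconv hX

end Assembly

end AmbiguityStopping
theorem theorem3 {S Ω : Type*} [MetricSpace S] [CompactSpace S] [MeasurableSpace S] [BorelSpace S]
    [mΩ : MeasurableSpace Ω] {T : ℝ} (hT : 0 < T)
    (P : Measure Ω) [IsProbabilityMeasure P]
    (𝓕 : Filtration (AmbiguityStopping.Time T) mΩ)
    (husual : AmbiguityStopping.UsualConditions P 𝓕)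
    (hnonatomic : ∀ t : AmbiguityStopping.Time T, 0 < (t : ℝ) →
      AmbiguityStopping.NonAtomicOn P (𝓕 t))
    (Y : AmbiguityStopping.Time T → Ω → ℝ)
    (hYadapted : Adapted 𝓕 Y)
    (hYright : ∀ ω t, ContinuousWithinAt (fun s => Y s ω) (Set.Ici t) t)
    (μ₀ : ProbabilityMeasure S)
    (κ : Kernel S Ω) [IsMarkovKernel κ]
    (v : ℝ → EReal) (hv : AmbiguityStopping.IsUtility v)
    (h_ac : ∀ θ, κ θ ≪ P)
    (h_int : AmbiguityStopping.UniformlyIntegrablePayoff κ Y)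
    (h_stop : AmbiguityStopping.ContinuousAlongStopTimes P 𝓕 κ Y)
    (h_scen : AmbiguityStopping.ContinuousInScenario P κ Y) :
    AmbiguityStopping.IsDualFunction μ₀ v (AmbiguityStopping.dualFunction μ₀ v) ∧
    ∀ R : ProbabilityMeasure S → ℝ → EReal, AmbiguityStopping.IsDualFunction μ₀ v R →
      AmbiguityStopping.ContinuityAlternative 𝓕 κ Y R →
      (⨆ τ : AmbiguityStopping.StopTime 𝓕,
          AmbiguityStopping.certaintyEquiv μ₀ v (AmbiguityStopping.scenarioValue κ Y τ))
        = (⨆ τ : AmbiguityStopping.StopTime 𝓕, ⨅ Q : ProbabilityMeasure S,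
            AmbiguityStopping.dualGain R κ Y τ Q) ∧
      (⨆ τ : AmbiguityStopping.StopTime 𝓕, ⨅ Q : ProbabilityMeasure S,
          AmbiguityStopping.dualGain R κ Y τ Q)
        = (⨅ Q : ProbabilityMeasure S, ⨆ τ : AmbiguityStopping.StopTime 𝓕,
            AmbiguityStopping.dualGain R κ Y τ Q) ∧
      ∀ Q : ProbabilityMeasure S, ∃ s : ℝ,
        IsLUB (Set.range fun τ : AmbiguityStopping.StopTime 𝓕 =>
          AmbiguityStopping.mixedValue κ Y τ Q) s ∧
        (⨆ τ : AmbiguityStopping.StopTime 𝓕, AmbiguityStopping.dualGain R κ Y τ Q) = R Q s := by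
  have := AmbiguityStopping.nonempty_stopTime hT.le 𝓕
  refine ⟨AmbiguityStopping.isDualFunction_dualFunction hv, fun R hR halt => ?_⟩
  open AmbiguityStopping in
  let X : StopTime 𝓕 → C(S, ℝ) := fun τ => ⟨scenarioValue κ Y τ,
    continuous_scenarioValue hYadapted hYright h_scen h_ac h_int τ⟩
  have hmixed : ∀ τ Q, mixedValue κ Y τ Q = ∫ θ, X τ θ ∂(Q : Measure S) :=
    mixedValue_eq_integral hYadapted hYright h_int
  have hcont : ∀ Z ∈ convexHull ℝ (Set.range X), ∀ Q,
      ContinuousAt (R Q) (∫ θ, Z θ ∂(Q : Measure S)) := by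
    intro Z hZ Q
    rcases halt with h | ⟨h, hpos⟩
    · exact (h Q).continuousAt
    -- Positivity passes to the convex hull, so its integrals stay in the half-line where `R Q` is
    -- continuous.
    · refine (h Q).continuousAt (Ioi_mem_nhds (integral_pos_of_forall_pos Q fun θ => ?_))
      refine forall_pos_of_mem_convexHull ?_ hZ θ
      rintro _ ⟨τ, rfl⟩ θ
      exact hpos τ θ
  have hdense : convexHull ℝ (Set.range X) ⊆ closure (Set.range X) := by
    refine convexHull_subset_closure ?_
    rintro _ ⟨τ₁, rfl⟩ _ ⟨τ₂, rfl⟩ a b ha hb hab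
    obtain rfl : b = 1 - a := by linarith
    refine Metric.mem_closure_iff.2 fun ε hε => ?_
    -- The error 6 · ε/12 = ε/2 leaves room for the strict inequality.
    obtain ⟨τ, hτ⟩ := exists_scenarioValue_approx_combination hT hnonatomic hYadapted hYright h_ac
      h_int h_stop h_scen τ₁ τ₂ ha (sub_nonneg.1 hb) (ε := ε / 12) (by positivity)
    refine ⟨_, ⟨τ, rfl⟩, ?_⟩
    refine lt_of_le_of_lt ((ContinuousMap.dist_le (by positivity)).2 fun θ => ?_) (half_lt_self hε)
    rw [dist_comm, Real.dist_eq]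
    refine (hτ θ).trans (le_of_eq (by ring))
  have hrep : ∀ τ : StopTime 𝓕, certaintyEquiv μ₀ v (scenarioValue κ Y τ) = ⨅ Q, dualGain R κ Y τ Q := by
    intro τ
    simp only [dualGain, hmixed]
    exact hR.represents (X τ)
  have hminimax := hR.iSup_certaintyEquiv_eq_iInf_iSup hdense hcont
  simp only [iSup_range] at hminimax
  have hfirst := iSup_congr hrep
  refine ⟨hfirst, ?_, fun Q => ?_⟩
  · rw [← hfirst]
    simp only [dualGain, hmixed]
    exact hminimax
  · obtain ⟨C, hC⟩ := h_int.exists_bound (𝓕 := 𝓕)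
    have hbdd : BddAbove (Set.range fun τ : StopTime 𝓕 => mixedValue κ Y τ Q) := by
      refine ⟨C, ?_⟩
      rintro _ ⟨τ, rfl⟩
      have h := integral_mono (integrable_continuousMap (Q : Measure S) (X τ))
        (integrable_const C) fun θ => (le_abs_self _).trans (hC τ θ)
      simpa [hmixed] using h
    have hlub := isLUB_csSup (Set.range_nonempty _) hbdd
    refine ⟨_, hlub, le_antisymm (iSup_le fun τ => hR.mono Q (hlub.1 ⟨τ, rfl⟩)) ?_⟩
    set s := sSup (Set.range fun τ : StopTime 𝓕 => mixedValue κ Y τ Q)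
    have hs : ContinuousAt (R Q) s := by
      rcases halt with h | ⟨h, hpos⟩
      · exact (h Q).continuousAt
      -- One stopping time already makes the supremum positive.
      · obtain ⟨τ⟩ : Nonempty (StopTime 𝓕) := inferInstance
        refine (h Q).continuousAt (Ioi_mem_nhds (lt_of_lt_of_le ?_ (hlub.1 ⟨τ, rfl⟩)))
        change 0 < mixedValue κ Y τ Q
        rw [hmixed]
        exact integral_pos_of_forall_pos Q (hpos τ)
    -- Left-continuity at `s` gives `t < s` with `R Q t` still above `c`, and some stopping time has
    -- value beyond `t`.
    refine le_of_forall_lt fun c hc => ?_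
    obtain ⟨t, hts, hct⟩ := exists_lt_lt_of_continuousAt hs hc
    obtain ⟨_, ⟨τ, rfl⟩, hτ⟩ := (lt_isLUB_iff hlub).1 hts
    exact (hct.trans_le (hR.mono Q hτ.le)).trans_le (le_iSup (fun τ => dualGain R κ Y τ Q) τ)
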